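/- Let $\alpha>0$ and $\beta\in\mathbb R$. Define $T_{\alpha,\beta}:\mathbb R\to\mathbb R$ by $T_{\alpha,\beta}(\beta)=\beta$ and $$T_{\alpha,\beta}(x)=\frac{\alpha}{2}\Bigl(\frac{x+\beta}{\alpha}-\frac{\alpha}{x-\beta}\Bigr)\qquad(x\neq\beta),$$ and let $\mu_{\alpha,\beta}$ be the Cauchy probability measure $\frac{\alpha}{\pi}\frac{dt}{\alpha^2+(t-\beta)^2}$ on $\mathbb R$. Let $(k_n)_{n\ge 0}$ be a sequence of natural numbers such that: * for some $p\in[1,\infty]$ it is $L^p$-good universal, i.e. for every measure preserving map $T$ of a probability space $(X,\mathcal A,\mu)$ and every $g\in L^p(\mu)$, $\lim_{N\to\infty}\frac1N\sum_{n=0}^{N-1}g(T^{k_n}x)$ exists for $\mu$-almost every $x$; * it is Hartman uniformly distributed, i.e. it is uniformly distributed among the residue classes modulo $m$ for every natural number $m>1$, and $(k_n\theta)_n$ is uniformly distributed modulo one for every irrational $\theta$. Let $k\ge 0$ be an integer and let $s\in\mathbb C$ with $\Re(s)>-\frac12$ and $\Re(s)\ne1$. Assume moreover that the $k_n$ are pairwise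 distinct (for instance, strictly increasing), or else that the function $\tau\mapsto\zeta^{(k)}(s+i\tau)$ belongs to $L^p(\mu_{\alpha,\beta})$ for the above $p$. Then for Lebesgue-almost every $x\in\mathbb R$ $$\lim_{N\to\infty}\frac1N\sum_{n=0}^{N-1}\zeta^{(k)}\bigl(s+iT_{\alpha,\beta}^{k_n}(x)\bigr)=l^{(k)}_{\alpha,\beta}(s):=\frac{\alpha}{\pi}\int_{\mathbb R}\frac{\zeta^{(k)}(s+i\tau)}{\alpha^2+(\tau-\beta)^2}\,d\tau,$$ where the integral converges absolutely. Moreover $$l^{(k)}_{\alpha,\beta}(s)=\begin{cases}\zeta^{(k)}(s+\alpha+i\beta)+P_k(s),&-\frac12<\Re(s)<1,\ s\ne1-\alpha-i\beta,\\[2pt](-1)^k\gamma_k-\dfrac{k!}{(2\alpha)^{k+1}},&-\frac12<\Re(s)<1,\ s=1-\alpha-i\beta,\\[2pt]\zeta^{(k)}(s+\alpha+i\beta),&\Re(s)>1,\end{cases}$$ where $$P_k(s)=\frac{(-1)^kk!}{i^{k+1}}\left(\frac1{(\beta+i\alpha-i(s-1))^{k+1}}-\frac1{(\beta-i\alpha-i(s-1))^{k+1}}\right)$$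 and $\gamma_k=\lim_{N\to\infty}\Bigl(\sum_{n=1}^N\frac{\log^kn}{n}-\frac{\log^{k+1}N}{k+1}\Bigr)$ (this limit exists). -/

import Mathlib

open Filter Topology MeasureTheory ProbabilityTheory
open scoped ENNReal

noncomputable section

/-- `κ` is `L^p`-good universal: for every dynamical system (a measure preserving self-map `T` of a
probability space) and every `g ∈ L^p`, the averages of `g` along `T^{κ 0} x, T^{κ 1} x, …`
converge for almost every `x`. -/
def IsGoodUniversal (p : ℝ≥0∞) (κ : ℕ → ℕ) : Prop :=
  ∀ (X : Type) [MeasurableSpace X] (μ : Measure X) [IsProbabilityMeasure μ] (T : X → X),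
    MeasurePreserving T μ μ → ∀ g : X → ℂ, MemLp g p μ →
      ∀ᵐ x ∂μ, ∃ l : ℂ,
        Tendsto (fun N : ℕ => (N : ℂ)⁻¹ * ∑ n ∈ Finset.range N, g (T^[κ n] x)) atTop (𝓝 l)

open Classical in
/-- Uniform distribution modulo one: for every interval `I ⊆ [0, 1)` the proportion of the first
`N` fractional parts that lie in `I` tends to the length of `I`. -/
def IsUniformlyDistributedModOne (x : ℕ → ℝ) : Prop :=
  ∀ I : Set ℝ, I.OrdConnected → I ⊆ Set.Ico 0 1 →
    Tendsto (fun N : ℕ => (((Finset.range N).filter (fun n => Int.fract (x n) ∈ I)).card : ℝ) / N)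
      atTop (𝓝 (volume.real I))

/-- Uniform distribution on `ℤ`: for every `m > 1` each residue class modulo `m` is visited with
frequency `1 / m`. -/
def IsUniformlyDistributedInt (κ : ℕ → ℕ) : Prop :=
  ∀ m : ℕ, 1 < m → ∀ r : ℕ,
    Tendsto (fun N : ℕ => (((Finset.range N).filter (fun n => κ n ≡ r [MOD m])).card : ℝ) / N)
      atTop (𝓝 (1 / (m : ℝ)))

/-- Hartman uniform distribution of a sequence of natural numbers. -/
def IsHartmanUniformlyDistributed (κ : ℕ → ℕ) : Prop :=
  IsUniformlyDistributedInt κ ∧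
    ∀ θ : ℝ, Irrational θ → IsUniformlyDistributedModOne (fun n => (κ n : ℝ) * θ)

/-- The Boole-type transformation `T_{α,β}` of the real line. -/
def booleMap (α β : ℝ) (x : ℝ) : ℝ :=
  if x = β then β else α / 2 * ((x + β) / α - α / (x - β))

/-- The `k`-th derivative of the Riemann zeta function. -/
def zetaDeriv (k : ℕ) : ℂ → ℂ := iteratedDeriv k riemannZeta

/-- The Cauchy kernel times `ζ^{(k)}` on the vertical line through `s`. -/
def zetaCauchyIntegrand (α β : ℝ) (k : ℕ) (s : ℂ) (τ : ℝ) : ℂ :=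
  zetaDeriv k (s + Complex.I * τ) / ((α ^ 2 + (τ - β) ^ 2 : ℝ) : ℂ)

/-- The Cauchy-weighted integral `l^{(k)}_{α,β}(s)` of `ζ^{(k)}`. -/
def zetaCauchyIntegral (α β : ℝ) (k : ℕ) (s : ℂ) : ℂ :=
  ((α / Real.pi : ℝ) : ℂ) * ∫ τ : ℝ, zetaCauchyIntegrand α β k s τ

/-- The pole correction `P_k(s)`. -/
def poleCorrection (α β : ℝ) (k : ℕ) (s : ℂ) : ℂ :=
  ((-1) ^ k * (k.factorial : ℂ)) / Complex.I ^ (k + 1) *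
    (1 / ((β : ℂ) + Complex.I * α - Complex.I * (s - 1)) ^ (k + 1) -
      1 / ((β : ℂ) - Complex.I * α - Complex.I * (s - 1)) ^ (k + 1))

/-- The sequence whose limit is the `k`-th Stieltjes constant. -/
def stieltjesSeq (k N : ℕ) : ℝ :=
  ∑ n ∈ Finset.Icc 1 N, Real.log n ^ k / n - Real.log N ^ (k + 1) / (k + 1)

/-- The `k`-th Stieltjes constant `γ_k`. -/
def stieltjesConstant (k : ℕ) : ℝ := limUnder atTop (stieltjesSeq k)

end

/-- The `n`-th increment of `(s - 1) ∑ m⁻ˢ + N ^ (1 - s)`. -/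
noncomputable def zetaIncrement (n : ℕ) (s : ℂ) : ℂ :=
  (s - 1) * ((n + 2 : ℕ) : ℂ) ^ (-s) + ((n + 2 : ℕ) : ℂ) ^ (1 - s) - ((n + 1 : ℕ) : ℂ) ^ (1 - s)

lemma sum_zetaIncrement (N : ℕ) (s : ℂ) :
    s + ∑ n ∈ Finset.range N, zetaIncrement n s =
      (s - 1) * ∑ n ∈ Finset.range (N + 1), ((n + 1 : ℕ) : ℂ) ^ (-s)
        + ((N + 1 : ℕ) : ℂ) ^ (1 - s) := by
  induction N with
  | zero => simp
  | succ N ih =>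
    rw [Finset.sum_range_succ, ← add_assoc, ih, Finset.sum_range_succ _ (N + 1), zetaIncrement]
    ring

lemma differentiable_zetaIncrement (n : ℕ) : Differentiable ℂ (zetaIncrement n) := by
  unfold zetaIncrement
  intro s
  have h1 : ((n + 2 : ℕ) : ℂ) ≠ 0 := Nat.cast_ne_zero.2 (by omega)
  have h2 : ((n + 1 : ℕ) : ℂ) ≠ 0 := Nat.cast_ne_zero.2 (by omega)
  have h3 : DifferentiableAt ℂ (fun s : ℂ => ((n + 2 : ℕ) : ℂ) ^ (-s)) s :=
    (differentiableAt_id.neg).const_cpow (Or.inl h1)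
  have h4 : DifferentiableAt ℂ (fun s : ℂ => ((n + 2 : ℕ) : ℂ) ^ (1 - s)) s :=
    ((differentiableAt_const _).sub differentiableAt_id).const_cpow (Or.inl h1)
  have h5 : DifferentiableAt ℂ (fun s : ℂ => ((n + 1 : ℕ) : ℂ) ^ (1 - s)) s :=
    ((differentiableAt_const _).sub differentiableAt_id).const_cpow (Or.inl h2)
  exact (((differentiableAt_id.sub_const 1).mul h3).add h4).sub h5

lemma norm_zetaIncrement_le (n : ℕ) {s : ℂ} (hs : 0 < s.re) :
    ‖zetaIncrement n s‖ ≤ ‖s‖ * ‖s - 1‖ * ((n + 1 : ℕ) : ℝ) ^ (-(s.re + 1)) := by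
  obtain ⟨φ, hφ⟩ : ∃ φ : ℝ → ℂ, ∀ x, φ x =
      (s - 1) * ((x : ℂ) - (n + 1)) * (x : ℂ) ^ (-s) + (x : ℂ) ^ (1 - s) := ⟨_, fun _ => rfl⟩
  obtain ⟨φ', hφ'⟩ : ∃ φ' : ℝ → ℂ, ∀ x, φ' x =
      -(s * (s - 1)) * ((x : ℂ) - (n + 1)) * (x : ℂ) ^ (-s - 1) := ⟨_, fun _ => rfl⟩
  have hd : ∀ x ∈ Set.Icc ((n : ℝ) + 1) (n + 2),
      HasDerivWithinAt φ (φ' x) (Set.Icc ((n : ℝ) + 1) (n + 2)) x := by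
    intro x hx
    have hx0 : (0 : ℝ) < x := by exact lt_of_lt_of_le (by positivity) hx.1
    have hxs : (x : ℂ) ∈ Complex.slitPlane := Complex.ofReal_mem_slitPlane.2 hx0
    have hxc : (x : ℂ) ≠ 0 := by exact_mod_cast hx0.ne'
    have h1 : HasDerivAt (fun z : ℂ => z ^ (-s)) ((-s) * (x : ℂ) ^ (-s - 1) * 1) (x : ℂ) :=
      (hasDerivAt_id _).cpow_const hxs
    have h2 : HasDerivAt (fun z : ℂ => z ^ (1 - s)) ((1 - s) * (x : ℂ) ^ (1 - s - 1) * 1) (x : ℂ) :=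
      (hasDerivAt_id _).cpow_const hxs
    have h3 : HasDerivAt (fun z : ℂ => (s - 1) * (z - (n + 1)) * z ^ (-s) + z ^ (1 - s)) (φ' x)
        (x : ℂ) := by
      convert! ((((hasDerivAt_id (x : ℂ)).sub_const ((n : ℂ) + 1)).const_mul (s - 1)).mul h1).add h2
        using 1
      have e1 : (x : ℂ) ^ (1 - s - 1) = (x : ℂ) ^ (-s) := by congr 1; ring
      have e2 : (x : ℂ) ^ (-s) = (x : ℂ) ^ (-s - 1) * x := by
        rw [Complex.cpow_sub _ _ hxc, Complex.cpow_one, div_mul_cancel₀ _ hxc]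
      simp only [hφ', id, e1, e2]
      ring
    exact (h3.comp_ofReal.congr_of_eventuallyEq (Eventually.of_forall hφ)).hasDerivWithinAt
  have hb : ∀ x ∈ Set.Ico ((n : ℝ) + 1) (n + 2),
      ‖φ' x‖ ≤ ‖s‖ * ‖s - 1‖ * ((n + 1 : ℕ) : ℝ) ^ (-(s.re + 1)) := by
    intro x hx
    have hx0 : (0 : ℝ) < x := by exact lt_of_lt_of_le (by positivity) hx.1
    have hxn : ‖(x : ℂ) - (n + 1)‖ ≤ 1 := by
      rw [show (x : ℂ) - (n + 1) = ((x - (n + 1) : ℝ) : ℂ) by push_cast; ring, Complex.norm_real,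
        Real.norm_eq_abs, abs_le]
      constructor <;> linarith [hx.1, hx.2]
    have hp : x ^ (-s.re - 1) ≤ ((n + 1 : ℕ) : ℝ) ^ (-(s.re + 1)) := by
      rw [show -s.re - 1 = -(s.re + 1) by ring]
      apply Real.rpow_le_rpow_of_nonpos (by positivity) _ (by linarith)
      push_cast; exact hx.1
    rw [hφ', norm_mul, norm_mul, norm_neg, norm_mul, Complex.norm_cpow_eq_rpow_re_of_pos hx0]
    have : (-s - 1).re = -s.re - 1 := by simp
    rw [this]
    calc ‖s‖ * ‖s - 1‖ * ‖(x : ℂ) - (n + 1)‖ * x ^ (-s.re - 1)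
        ≤ ‖s‖ * ‖s - 1‖ * 1 * ((n + 1 : ℕ) : ℝ) ^ (-(s.re + 1)) := by gcongr
      _ = _ := by ring
  have := norm_image_sub_le_of_norm_deriv_le_segment' hd hb ((n : ℝ) + 2) ⟨by linarith, le_rfl⟩
  rw [hφ, hφ, show (n : ℝ) + 2 - (n + 1) = 1 by ring, mul_one] at this
  convert! this using 2
  rw [zetaIncrement]
  push_cast
  ring_nf

lemma summable_nat_add_one_rpow {σ : ℝ} (hσ : 0 < σ) :
    Summable fun n : ℕ => ((n + 1 : ℕ) : ℝ) ^ (-(σ + 1)) :=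
  (summable_nat_add_iff (f := fun n : ℕ => (n : ℝ) ^ (-(σ + 1))) 1).2
    (Real.summable_nat_rpow.2 (by linarith))

lemma norm_zetaIncrement_le_of_le (n : ℕ) {σ : ℝ} (hσ : 0 < σ) {s : ℂ} (hs : σ ≤ s.re) :
    ‖zetaIncrement n s‖ ≤ ‖s‖ * ‖s - 1‖ * ((n + 1 : ℕ) : ℝ) ^ (-(σ + 1)) := by
  refine (norm_zetaIncrement_le n (hσ.trans_le hs)).trans ?_
  gcongr
  · norm_cast; omega

lemma isOpen_re_gt (σ : ℝ) : IsOpen {s : ℂ | σ < s.re} :=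
  isOpen_lt continuous_const Complex.continuous_re

lemma tendstoLocallyUniformlyOn_sum_zetaIncrement :
    TendstoLocallyUniformlyOn (fun (N : ℕ) s => s + ∑ n ∈ Finset.range N, zetaIncrement n s)
      (fun s => s + ∑' n, zetaIncrement n s) atTop {s : ℂ | 0 < s.re} := by
  rw [tendstoLocallyUniformlyOn_iff_forall_isCompact (isOpen_re_gt 0)]
  intro K hK hKc
  rcases K.eq_empty_or_nonempty with rfl | hne
  · exact tendstoUniformlyOn_empty
  obtain ⟨z, hz, hzmin⟩ := hKc.exists_isMinOn hne Complex.continuous_re.continuousOn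
  obtain ⟨M, hM⟩ := hKc.exists_bound_of_continuousOn
    (f := fun s : ℂ => ‖s‖ * ‖s - 1‖) (by fun_prop)
  have hzp : 0 < z.re := hK hz
  have := tendstoUniformlyOn_tsum_nat (f := zetaIncrement) (s := K)
    ((summable_nat_add_one_rpow hzp).mul_left M) (fun n s hs => by
      refine (norm_zetaIncrement_le_of_le n hzp (hzmin hs)).trans ?_
      gcongr
      exact (le_abs_self _).trans (hM s hs))
  rw [Metric.tendstoUniformlyOn_iff] at this ⊢
  simpa [dist_add_left] using this

lemma differentiableOn_tsum_zetaIncrement :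
    DifferentiableOn ℂ (fun s => s + ∑' n, zetaIncrement n s) {s : ℂ | 0 < s.re} := by
  refine tendstoLocallyUniformlyOn_sum_zetaIncrement.differentiableOn
    (Eventually.of_forall fun N => ?_) (isOpen_re_gt 0)
  have : Differentiable ℂ fun s : ℂ => s + ∑ n ∈ Finset.range N, zetaIncrement n s :=
    differentiable_id.add (Differentiable.fun_sum fun n _ => differentiable_zetaIncrement n)
  exact this.differentiableOn

lemma riemannZeta₁_eq_mul {s : ℂ} (hs : s ≠ 1) : riemannZeta₁ s = (s - 1) * riemannZeta s := by
  have : s - 1 ≠ 0 := sub_ne_zero.2 hs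
  rw [riemannZeta_eq_inv_sub_mul hs]
  field_simp

lemma riemannZeta₁_eq_tsum_of_one_lt_re {s : ℂ} (hs : 1 < s.re) :
    riemannZeta₁ s = s + ∑' n, zetaIncrement n s := by
  have hs1 : s ≠ 1 := by rintro rfl; simp at hs
  have h1 : Tendsto (fun N : ℕ => s + ∑ n ∈ Finset.range N, zetaIncrement n s) atTop
      (𝓝 (s + ∑' n, zetaIncrement n s)) :=
    tendstoLocallyUniformlyOn_sum_zetaIncrement.tendsto_at (by simp; linarith)
  refine tendsto_nhds_unique ?_ h1
  simp_rw [sum_zetaIncrement]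
  rw [riemannZeta₁_eq_mul hs1, ← add_zero ((s - 1) * riemannZeta s)]
  have hsum : HasSum (fun n : ℕ => ((n + 1 : ℕ) : ℂ) ^ (-s)) (riemannZeta s) := by
    rw [zeta_eq_tsum_one_div_nat_add_one_cpow hs]
    have := (Complex.summable_one_div_nat_cpow.2 hs)
    have := ((summable_nat_add_iff 1).2 this).hasSum
    simpa only [Complex.cpow_neg, one_div, Nat.cast_add, Nat.cast_one] using this
  refine ((hsum.tendsto_sum_nat.comp (tendsto_add_atTop_nat 1)).const_mul _).add ?_
  rw [tendsto_zero_iff_norm_tendsto_zero]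
  have : ∀ N : ℕ, ‖((N + 1 : ℕ) : ℂ) ^ (1 - s)‖ = ((N + 1 : ℕ) : ℝ) ^ (-(s.re - 1)) := by
    intro N
    rw [← Complex.ofReal_natCast, Complex.norm_cpow_eq_rpow_re_of_pos (by positivity)]
    simp
  simp_rw [this]
  exact (tendsto_rpow_neg_atTop (by linarith : 0 < s.re - 1)).comp
    (tendsto_natCast_atTop_atTop.comp (tendsto_add_atTop_nat 1))

lemma riemannZeta₁_eq_tsum {s : ℂ} (hs : 0 < s.re) :
    riemannZeta₁ s = s + ∑' n, zetaIncrement n s := by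
  have hU : IsPreconnected {s : ℂ | 0 < s.re} := (convex_halfSpace_re_gt 0).isPreconnected
  have h1 := (differentiable_riemannZeta₁.differentiableOn).analyticOnNhd (isOpen_re_gt 0)
  have h2 := differentiableOn_tsum_zetaIncrement.analyticOnNhd (isOpen_re_gt 0)
  refine h1.eqOn_of_preconnected_of_eventuallyEq h2 hU (z₀ := 2) (by simp) ?_ hs
  filter_upwards [(isOpen_re_gt 1).mem_nhds (show (2 : ℂ) ∈ {s : ℂ | 1 < s.re} by simp)] with z hz
  exact riemannZeta₁_eq_tsum_of_one_lt_re hz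

lemma exists_norm_riemannZeta₁_le {σ : ℝ} (hσ : 0 < σ) :
    ∃ C, ∀ s : ℂ, σ ≤ s.re → ‖riemannZeta₁ s‖ ≤ ‖s‖ + C * (‖s‖ * ‖s - 1‖) := by
  refine ⟨∑' n : ℕ, ((n + 1 : ℕ) : ℝ) ^ (-(σ + 1)), fun s hs => ?_⟩
  rw [riemannZeta₁_eq_tsum (hσ.trans_le hs)]
  refine (norm_add_le _ _).trans (add_le_add le_rfl ?_)
  refine (tsum_of_norm_bounded ((summable_nat_add_one_rpow hσ).hasSum.mul_left (‖s‖ * ‖s - 1‖))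
    (fun n => norm_zetaIncrement_le_of_le n hσ hs)).trans (le_of_eq (mul_comm _ _))

lemma TendstoLocallyUniformlyOn.iteratedDeriv_complex {ι : Type*} {φ : Filter ι} {F : ι → ℂ → ℂ}
    {f : ℂ → ℂ} {U : Set ℂ} (hf : TendstoLocallyUniformlyOn F f φ U)
    (hF : ∀ i, Differentiable ℂ (F i)) (hU : IsOpen U) (k : ℕ) :
    TendstoLocallyUniformlyOn (fun i => iteratedDeriv k (F i)) (iteratedDeriv k f) φ U := by
  induction k with
  | zero => simpa using hf
  | succ k ih =>
    simp_rw [iteratedDeriv_succ]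
    exact ih.deriv (Eventually.of_forall fun i =>
      (((hF i).contDiff (n := ⊤)).differentiable_iteratedDeriv k (by simp)).differentiableOn) hU

lemma Differentiable.iteratedDeriv_complex {f : ℂ → ℂ} (hf : Differentiable ℂ f) (k : ℕ) :
    Differentiable ℂ (iteratedDeriv k f) :=
  (hf.contDiff (n := ⊤)).differentiable_iteratedDeriv k (by simp)

lemma iteratedDeriv_succ_sub_mul {f : ℂ → ℂ} (hf : Differentiable ℂ f) (c : ℂ) (k : ℕ) (z : ℂ) :
    iteratedDeriv (k + 1) (fun z => (z - c) * f z) z =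
      (z - c) * iteratedDeriv (k + 1) f z + (k + 1) * iteratedDeriv k f z := by
  induction k generalizing z with
  | zero =>
    have := ((hasDerivAt_id z).sub_const c).mul (hf z).hasDerivAt
    simp only [zero_add, iteratedDeriv_one, iteratedDeriv_zero]
    refine this.deriv.trans ?_
    simp; ring
  | succ k ih =>
    rw [iteratedDeriv_succ, funext ih]
    have := (((hasDerivAt_id z).sub_const c).mul (hf.iteratedDeriv_complex (k + 1) z).hasDerivAt).add
      ((hf.iteratedDeriv_complex k z).hasDerivAt.const_mul ((k : ℂ) + 1))
    refine this.deriv.trans ?_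
    rw [← iteratedDeriv_succ, ← iteratedDeriv_succ]
    push_cast; simp; ring

lemma iteratedDeriv_exp_mul_sub (a c : ℂ) (k : ℕ) (z : ℂ) :
    iteratedDeriv k (fun z => Complex.exp (a * (c - z))) z = (-a) ^ k * Complex.exp (a * (c - z)) := by
  induction k generalizing z with
  | zero => simp
  | succ k ih =>
    rw [iteratedDeriv_succ, funext ih]
    have h : HasDerivAt (fun z : ℂ => a * (c - z)) (a * -1) z :=
      ((hasDerivAt_id z).const_sub c).const_mul a
    refine (h.cexp.const_mul ((-a) ^ k)).deriv.trans ?_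
    ring

lemma natCast_cpow_eq_exp {n : ℕ} (hn : n ≠ 0) (w : ℂ) :
    (n : ℂ) ^ w = Complex.exp ((Real.log n : ℂ) * w) := by
  rw [Complex.cpow_def_of_ne_zero (by exact_mod_cast hn), Complex.natCast_log]

lemma differentiable_natCast_cpow {n : ℕ} (hn : n ≠ 0) (c : ℂ) :
    Differentiable ℂ fun s : ℂ => (n : ℂ) ^ (c - s) := by
  simp_rw [natCast_cpow_eq_exp hn]
  fun_prop

lemma iteratedDeriv_natCast_cpow {n : ℕ} (hn : n ≠ 0) (c : ℂ) (k : ℕ) (s : ℂ) :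
    iteratedDeriv k (fun s : ℂ => (n : ℂ) ^ (c - s)) s = (-(Real.log n : ℂ)) ^ k * (n : ℂ) ^ (c - s) := by
  simp_rw [natCast_cpow_eq_exp hn]
  rw [iteratedDeriv_exp_mul_sub]

/-- The derivatives at `1` of the partial sums are the Stieltjes sequence. -/
lemma iteratedDeriv_sum_zetaIncrement_one (k N : ℕ) :
    iteratedDeriv (k + 1) (fun s => s + ∑ n ∈ Finset.range N, zetaIncrement n s) 1 =
      (k + 1) * ((-1) ^ k * (stieltjesSeq k (N + 1) : ℂ)) := by
  have hpart : (fun s => s + ∑ n ∈ Finset.range N, zetaIncrement n s) = fun s =>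
      (s - 1) * ∑ n ∈ Finset.range (N + 1), ((n + 1 : ℕ) : ℂ) ^ (0 - s)
        + ((N + 1 : ℕ) : ℂ) ^ (1 - s) := by
    funext s
    rw [sum_zetaIncrement, zero_sub]
  rw [hpart]
  have hd : Differentiable ℂ fun s : ℂ => ∑ n ∈ Finset.range (N + 1), ((n + 1 : ℕ) : ℂ) ^ (0 - s) :=
    Differentiable.fun_sum fun n _ => differentiable_natCast_cpow n.succ_ne_zero 0
  have hd2 := differentiable_natCast_cpow N.succ_ne_zero 1
  have hd1 : Differentiable ℂ fun s : ℂ =>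
      (s - 1) * ∑ n ∈ Finset.range (N + 1), ((n + 1 : ℕ) : ℂ) ^ (0 - s) :=
    (differentiable_id.sub_const 1).mul hd
  have hsumd : iteratedDeriv k
      (fun s : ℂ => ∑ n ∈ Finset.range (N + 1), ((n + 1 : ℕ) : ℂ) ^ (0 - s)) 1 =
      ∑ n ∈ Finset.range (N + 1),
        (-(Real.log ((n + 1 : ℕ) : ℝ) : ℂ)) ^ k * (((n + 1 : ℕ) : ℂ))⁻¹ := by
    rw [iteratedDeriv_fun_sum (fun n _ =>
      (differentiable_natCast_cpow n.succ_ne_zero 0).contDiff.contDiffAt)]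
    refine Finset.sum_congr rfl fun n _ => ?_
    rw [iteratedDeriv_natCast_cpow n.succ_ne_zero, zero_sub, Complex.cpow_neg_one]
  have hsum : ∑ n ∈ Finset.Icc 1 (N + 1), Real.log n ^ k / (n : ℝ) =
      ∑ n ∈ Finset.range (N + 1), Real.log ((n + 1 : ℕ) : ℝ) ^ k / ((n + 1 : ℕ) : ℝ) := by
    rw [Finset.range_eq_Ico, Finset.sum_Ico_add' (fun n : ℕ => Real.log (n : ℝ) ^ k / (n : ℝ)) 0]
    rfl
  rw [iteratedDeriv_fun_add hd1.contDiff.contDiffAt hd2.contDiff.contDiffAt,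
    iteratedDeriv_succ_sub_mul hd, iteratedDeriv_natCast_cpow N.succ_ne_zero, hsumd, sub_self,
    zero_mul, zero_add, Complex.cpow_zero, mul_one, stieltjesSeq, hsum]
  have hk : (k : ℂ) + 1 ≠ 0 := by exact_mod_cast k.succ_ne_zero
  rw [Complex.ofReal_sub, Complex.ofReal_sum, mul_sub, mul_sub, sub_eq_add_neg]
  congr 1
  · simp only [Finset.mul_sum]
    refine Finset.sum_congr rfl fun n _ => ?_
    rw [neg_pow]
    push_cast
    ring
  · rw [neg_pow, pow_succ (-1 : ℂ)]
    push_cast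
    field_simp

lemma iteratedDeriv_riemannZeta₁_one (k : ℕ) :
    iteratedDeriv (k + 1) riemannZeta₁ 1 = (k + 1) * iteratedDeriv k riemannZeta₀ 1 := by
  have : riemannZeta₁ = fun s => 1 + (s - 1) * riemannZeta₀ s := rfl
  rw [this, iteratedDeriv_const_add (by omega), iteratedDeriv_succ_sub_mul differentiable_riemannZeta₀]
  simp

lemma tendsto_ofReal_stieltjesSeq (k : ℕ) :
    Tendsto (fun N => (stieltjesSeq k N : ℂ)) atTop
      (𝓝 ((-1) ^ k * iteratedDeriv k riemannZeta₀ 1)) := by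
  rw [← tendsto_add_atTop_iff_nat 1]
  have hloc : TendstoLocallyUniformlyOn
      (fun (N : ℕ) s => s + ∑ n ∈ Finset.range N, zetaIncrement n s) riemannZeta₁ atTop
      {s : ℂ | 0 < s.re} :=
    tendstoLocallyUniformlyOn_sum_zetaIncrement.congr_right
      fun s hs => (riemannZeta₁_eq_tsum hs).symm
  have h := (hloc.iteratedDeriv_complex (fun N => differentiable_id.add
    (Differentiable.fun_sum fun n _ => differentiable_zetaIncrement n)) (isOpen_re_gt 0)
    (k + 1)).tendsto_at (a := 1) (by simp)
  rw [iteratedDeriv_riemannZeta₁_one] at h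
  simp_rw [iteratedDeriv_sum_zetaIncrement_one] at h
  have hk : (k : ℂ) + 1 ≠ 0 := by exact_mod_cast k.succ_ne_zero
  have h2 := h.const_mul ((-1) ^ k * ((k : ℂ) + 1)⁻¹)
  have e : ((-1 : ℂ) ^ k) * (-1) ^ k = 1 := by rw [← mul_pow]; simp
  convert! h2 using 2
  · rename_i N
    calc _ = ((-1 : ℂ) ^ k * (-1) ^ k) * (stieltjesSeq k (N + 1) : ℂ) := by rw [e, one_mul]
      _ = _ := by field_simp
  · field_simp

lemma tendsto_stieltjesSeq (k : ℕ) : Tendsto (stieltjesSeq k) atTop (𝓝 (stieltjesConstant k)) := by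
  have h := (Complex.continuous_re.tendsto _).comp (tendsto_ofReal_stieltjesSeq k)
  exact tendsto_nhds_limUnder ⟨_, h⟩

lemma iteratedDeriv_riemannZeta₀_one (k : ℕ) :
    iteratedDeriv k riemannZeta₀ 1 = (-1) ^ k * (stieltjesConstant k : ℂ) := by
  have h := tendsto_nhds_unique (tendsto_ofReal_stieltjesSeq k)
    ((Complex.continuous_ofReal.tendsto _).comp (tendsto_stieltjesSeq k))
  rw [← h, ← mul_assoc, ← mul_pow]
  simp

lemma norm_Gamma_le_Gamma_re {s : ℂ} (hs : 0 < s.re) : ‖Complex.Gamma s‖ ≤ Real.Gamma s.re := by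
  rw [Complex.Gamma_eq_integral hs, Real.Gamma_eq_integral hs, Complex.GammaIntegral]
  refine (norm_integral_le_integral_norm _).trans (le_of_eq ?_)
  refine setIntegral_congr_fun measurableSet_Ioi fun x (hx : 0 < x) => ?_
  simp [Complex.norm_cpow_eq_rpow_re_of_pos hx, Complex.norm_exp]

lemma norm_cos_le_cosh (z : ℂ) : ‖Complex.cos z‖ ≤ Real.cosh z.im := by
  rw [Complex.cos, norm_div, Complex.norm_ofNat, Real.cosh_eq]
  gcongr
  refine (norm_add_le _ _).trans (le_of_eq ?_)
  rw [Complex.norm_exp, Complex.norm_exp]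
  simp [add_comm]

lemma cosh_le_exp_abs (x : ℝ) : Real.cosh x ≤ Real.exp |x| := by
  rw [← Real.cosh_abs, Real.cosh_eq]
  have : Real.exp (-|x|) ≤ Real.exp |x| := Real.exp_le_exp.2 (by linarith [abs_nonneg x])
  linarith

lemma norm_Gamma_half_add_sq (t : ℝ) :
    ‖Complex.Gamma (1 / 2 + Complex.I * t)‖ ^ 2 = Real.pi / Real.cosh (Real.pi * t) := by
  have h := Complex.Gamma_mul_Gamma_one_sub (1 / 2 + Complex.I * t)
  have e1 : 1 - (1 / 2 + Complex.I * t) = (starRingEnd ℂ) (1 / 2 + Complex.I * t) := by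
    apply Complex.ext
    · simp; norm_num
    · simp
  have e2 : Complex.sin (Real.pi * (1 / 2 + Complex.I * t)) = (Real.cosh (Real.pi * t) : ℂ) := by
    rw [show (Real.pi : ℂ) * (1 / 2 + Complex.I * t) = (Real.pi * t : ℂ) * Complex.I + Real.pi / 2 by
      ring, Complex.sin_add_pi_div_two, Complex.cos_mul_I]
    push_cast; rfl
  rw [e1, Complex.Gamma_conj, Complex.mul_conj, Complex.normSq_eq_norm_sq, e2] at h
  exact_mod_cast h

lemma exists_norm_riemannZeta_le_of_re_ge {σ : ℝ} (hσ : 1 < σ) :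
    ∃ C, ∀ s : ℂ, σ ≤ s.re → ‖riemannZeta s‖ ≤ C := by
  have hsum := summable_nat_add_one_rpow (σ := σ - 1) (by linarith)
  refine ⟨∑' n : ℕ, ((n + 1 : ℕ) : ℝ) ^ (-(σ - 1 + 1)), fun s hs => ?_⟩
  rw [zeta_eq_tsum_one_div_nat_add_one_cpow (by linarith)]
  refine tsum_of_norm_bounded hsum.hasSum fun n => ?_
  rw [← Nat.cast_add_one, norm_div, norm_one, ← Complex.ofReal_natCast,
    Complex.norm_cpow_eq_rpow_re_of_pos (by positivity), one_div, ← Real.rpow_neg (by positivity)]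
  exact Real.rpow_le_rpow_of_exponent_le (by norm_cast; omega) (by linarith)

lemma norm_two_pi_cpow_le_one {s : ℂ} (hs : 0 ≤ s.re) : ‖(2 * (Real.pi : ℂ)) ^ (-s)‖ ≤ 1 := by
  have h := Real.pi_gt_three
  rw [show (2 * (Real.pi : ℂ)) = ((2 * Real.pi : ℝ) : ℂ) by push_cast; rfl,
    Complex.norm_cpow_eq_rpow_re_of_pos (by linarith)]
  exact Real.rpow_le_one_of_one_le_of_nonpos (by linarith) (by simpa using hs)

lemma norm_riemannZeta_one_sub_le {s : ℂ} (hs : 0 < s.re) (hs' : s ≠ 1) :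
    ‖riemannZeta (1 - s)‖ ≤
      2 * ‖Complex.Gamma s‖ * Real.cosh (Real.pi * s.im / 2) * ‖riemannZeta s‖ := by
  have hn : ∀ n : ℕ, s ≠ -n := by
    rintro n rfl
    have : (0 : ℝ) ≤ n := n.cast_nonneg
    simp at hs
    linarith
  have hc := norm_cos_le_cosh (Real.pi * s / 2)
  have him : ((Real.pi : ℂ) * s / 2).im = Real.pi * s.im / 2 := by
    rw [show (Real.pi : ℂ) * s / 2 = ((Real.pi / 2 : ℝ) : ℂ) * s by push_cast; ring,
      Complex.im_ofReal_mul]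
    ring
  rw [him] at hc
  rw [riemannZeta_one_sub hn hs', norm_mul, norm_mul, norm_mul, norm_mul, Complex.norm_ofNat]
  have := norm_two_pi_cpow_le_one hs.le
  calc _ ≤ 2 * 1 * ‖Complex.Gamma s‖ * Real.cosh (Real.pi * s.im / 2) * ‖riemannZeta s‖ := by gcongr
    _ = _ := by ring

lemma exists_norm_riemannZeta_neg_half_le :
    ∃ C, 0 ≤ C ∧ ∀ s : ℂ, s.re = -1 / 2 → ‖riemannZeta s‖ ≤ C * (1 + |s.im|) := by
  obtain ⟨B, hB⟩ := exists_norm_riemannZeta_le_of_re_ge (σ := 3 / 2) (by norm_num)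
  have hB0 : 0 ≤ B := (norm_nonneg _).trans (hB 2 (by norm_num))
  refine ⟨2 * Real.sqrt Real.pi * B, by positivity, fun s hs => ?_⟩
  set t : ℝ := -s.im with ht
  have hw : 1 - s = (1 / 2 + Complex.I * t) + 1 := by
    apply Complex.ext <;> simp [hs, ht]; norm_num
  have hne : (1 / 2 + Complex.I * t : ℂ) ≠ 0 := by
    intro h; have := congrArg Complex.re h; norm_num at this
  have h1 := norm_riemannZeta_one_sub_le (s := 1 - s) (by simp [hs]; norm_num)
    (by intro h; have := congrArg Complex.re h; simp [hs] at this)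
  rw [sub_sub_cancel] at h1
  have hG : ‖Complex.Gamma (1 - s)‖ * Real.cosh (Real.pi * (1 - s).im / 2) ≤
      Real.sqrt Real.pi * (1 + |s.im|) := by
    rw [hw, Complex.Gamma_add_one _ hne, norm_mul, mul_assoc, mul_comm]
    have him : ((1 / 2 + Complex.I * t + 1 : ℂ)).im = t := by simp
    rw [him]
    have hcosh : Real.cosh (Real.pi * t / 2) ^ 2 ≤ Real.cosh (Real.pi * t) := by
      have e1 := Real.cosh_two_mul (Real.pi * t / 2)
      have e2 := Real.cosh_sq (Real.pi * t / 2)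
      rw [show 2 * (Real.pi * t / 2) = Real.pi * t by ring] at e1
      nlinarith [sq_nonneg (Real.sinh (Real.pi * t / 2))]
    gcongr
    · apply Real.le_sqrt_of_sq_le
      rw [mul_pow, norm_Gamma_half_add_sq, div_mul_eq_mul_div, div_le_iff₀ (Real.cosh_pos _)]
      gcongr
    · refine (norm_add_le _ _).trans ?_
      rw [norm_mul, Complex.norm_I, one_mul, Complex.norm_real, Real.norm_eq_abs, ht, abs_neg]
      norm_num
  calc ‖riemannZeta s‖ ≤ _ := h1
    _ = 2 * (‖Complex.Gamma (1 - s)‖ * Real.cosh (Real.pi * (1 - s).im / 2)) *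
        ‖riemannZeta (1 - s)‖ := by ring
    _ ≤ 2 * (Real.sqrt Real.pi * (1 + |s.im|)) * B := by
      gcongr
      exact hB _ (by simp [hs]; norm_num)
    _ = _ := by ring

lemma norm_le_re_add_im {z : ℂ} {M : ℝ} (h : |z.re| ≤ M) : ‖z‖ ≤ M + |z.im| :=
  (Complex.norm_le_abs_re_add_abs_im z).trans (by linarith)

lemma exists_norm_riemannZeta₁_le_exp :
    ∃ C, ∀ s : ℂ, s.re ∈ Set.Icc (-1 / 2 : ℝ) (3 / 2) →
      ‖riemannZeta₁ s‖ ≤ C * Real.exp (5 * |s.im|) := by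
  obtain ⟨C₁, hC₁⟩ := exists_norm_riemannZeta₁_le (σ := 1 / 4) (by norm_num)
  have hx : ∀ x : ℝ, 0 ≤ x → 3 / 2 + x ≤ 2 * Real.exp x := fun x hx => by
    nlinarith [Real.add_one_le_exp x]
  have hright : ∀ s : ℂ, s.re ∈ Set.Icc (1 / 4 : ℝ) (3 / 2) →
      ‖riemannZeta₁ s‖ ≤ (2 + 4 * |C₁|) * Real.exp (2 * |s.im|) := by
    intro s hs
    have h1 : ‖s‖ ≤ 2 * Real.exp |s.im| :=
      (norm_le_re_add_im (M := 3 / 2) (abs_le.2 ⟨by linarith [hs.1], hs.2⟩)).trans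
        (hx _ (abs_nonneg _))
    have h2 : ‖s - 1‖ ≤ 2 * Real.exp |s.im| := by
      have := norm_le_re_add_im (z := s - 1) (M := 3 / 2)
        (abs_le.2 ⟨by simp; linarith [hs.1], by simp; linarith [hs.2]⟩)
      simp only [Complex.sub_im, Complex.one_im, sub_zero] at this
      exact this.trans (hx _ (abs_nonneg _))
    have h3 : Real.exp |s.im| ≤ Real.exp (2 * |s.im|) :=
      Real.exp_le_exp.2 (by linarith [abs_nonneg s.im])
    have h4 : Real.exp (2 * |s.im|) = Real.exp |s.im| * Real.exp |s.im| := by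
      rw [← Real.exp_add]; ring_nf
    calc ‖riemannZeta₁ s‖ ≤ ‖s‖ + C₁ * (‖s‖ * ‖s - 1‖) := hC₁ s hs.1
      _ ≤ ‖s‖ + |C₁| * (‖s‖ * ‖s - 1‖) := by gcongr; exact le_abs_self _
      _ ≤ 2 * Real.exp (2 * |s.im|) + |C₁| * ((2 * Real.exp |s.im|) * (2 * Real.exp |s.im|)) := by
        gcongr; linarith
      _ = _ := by rw [h4]; ring
  obtain ⟨M, hM⟩ := (isCompact_Icc (a := (3 / 4 : ℝ)) (b := 3 / 2)).exists_bound_of_continuousOn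
    (f := Real.Gamma) (fun x hx => (Real.differentiableAt_Gamma fun m => by
      have : (0 : ℝ) ≤ m := m.cast_nonneg
      have := hx.1
      linarith).continuousAt.continuousWithinAt)
  have hM0 : 0 ≤ M := (norm_nonneg _).trans (hM 1 ⟨by norm_num, by norm_num⟩)
  have hleft : ∀ s : ℂ, s.re ∈ Set.Icc (-1 / 2 : ℝ) (1 / 4) → 1 ≤ |s.im| →
      ‖riemannZeta₁ s‖ ≤ (4 * M * (2 + 4 * |C₁|)) * Real.exp (5 * |s.im|) := by
    intro s hs him
    have hs1 : s ≠ 1 := by rintro rfl; norm_num at hs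
    have hw1 : 1 - s ≠ 1 := by
      intro h; have := congrArg Complex.im h; simp at this; simp [this] at him; linarith
    have hwre : 0 < (1 - s).re := by simp; linarith [hs.2]
    have hwim : |(1 - s).im| = |s.im| := by simp
    have h0 := norm_riemannZeta_one_sub_le hwre hw1
    rw [sub_sub_cancel] at h0
    have hG : ‖Complex.Gamma (1 - s)‖ ≤ M := (norm_Gamma_le_Gamma_re hwre).trans
      ((le_abs_self _).trans (hM _ ⟨by simp; linarith [hs.2], by simp; linarith [hs.1]⟩))
    have hcosh : Real.cosh (Real.pi * (1 - s).im / 2) ≤ Real.exp (2 * |s.im|) := by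
      refine (cosh_le_exp_abs _).trans (Real.exp_le_exp.2 ?_)
      rw [abs_div, abs_mul, hwim, abs_of_pos Real.pi_pos, abs_two]
      nlinarith [Real.pi_lt_d2, abs_nonneg s.im]
    have hz : ‖riemannZeta (1 - s)‖ ≤ (2 + 4 * |C₁|) * Real.exp (2 * |s.im|) := by
      have h := hright (1 - s) ⟨by simp; linarith [hs.2], by simp; linarith [hs.1]⟩
      rw [hwim, riemannZeta₁_eq_mul hw1, norm_mul] at h
      refine le_trans ?_ h
      have : 1 ≤ ‖1 - s - 1‖ := by
        refine le_trans ?_ (Complex.abs_im_le_norm _)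
        simpa using him
      nlinarith [norm_nonneg (riemannZeta (1 - s))]
    have h2 : ‖s - 1‖ ≤ 2 * Real.exp |s.im| := by
      have := norm_le_re_add_im (z := s - 1) (M := 3 / 2)
        (abs_le.2 ⟨by simp; linarith [hs.1], by simp; linarith [hs.2]⟩)
      simp only [Complex.sub_im, Complex.one_im, sub_zero] at this
      exact this.trans (hx _ (abs_nonneg _))
    rw [riemannZeta₁_eq_mul hs1, norm_mul]
    calc ‖s - 1‖ * ‖riemannZeta s‖
        ≤ (2 * Real.exp |s.im|) * (2 * M * Real.exp (2 * |s.im|) *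
          ((2 + 4 * |C₁|) * Real.exp (2 * |s.im|))) := by
          gcongr
          refine h0.trans ?_
          have := Real.cosh_pos (Real.pi * (1 - s).im / 2)
          gcongr
      _ = (4 * M * (2 + 4 * |C₁|)) *
          (Real.exp |s.im| * Real.exp (2 * |s.im|) * Real.exp (2 * |s.im|)) := by ring
      _ = _ := by
        rw [← Real.exp_add, ← Real.exp_add]
        ring_nf
  obtain ⟨M', hM'⟩ := ((isCompact_Icc (a := (-1 / 2 : ℝ)) (b := 3 / 2)).reProdIm
    (isCompact_Icc (a := (-1 : ℝ)) (b := 1))).exists_bound_of_continuousOn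
    (f := riemannZeta₁) differentiable_riemannZeta₁.continuous.continuousOn
  refine ⟨max |M'| (max (2 + 4 * |C₁|) (4 * M * (2 + 4 * |C₁|))), fun s hs => ?_⟩
  rcases le_total |s.im| 1 with him | him
  · calc ‖riemannZeta₁ s‖ ≤ |M'| := (hM' s ⟨hs, abs_le.1 him⟩).trans (le_abs_self _)
      _ ≤ |M'| * Real.exp (5 * |s.im|) :=
        le_mul_of_one_le_right (abs_nonneg _) (Real.one_le_exp (by positivity))
      _ ≤ _ := by gcongr; exact le_max_left _ _
  · rcases le_total s.re (1 / 4) with hre | hre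
    · refine (hleft s ⟨hs.1, hre⟩ him).trans ?_
      gcongr
      exact (le_max_right _ _).trans (le_max_right _ _)
    · refine (hright s ⟨hre, hs.2⟩).trans ?_
      gcongr
      · exact (le_max_left _ _).trans (le_max_right _ _)
      · norm_num

open Complex.HadamardThreeLines in
/-- Convexity bound for `(s - 1) ζ(s)` between the lines `re s = -1/2` and `re s = 3/2`. -/
lemma exists_norm_riemannZeta₁_le_rpow :
    ∃ C, 0 ≤ C ∧ ∀ s : ℂ, s.re ∈ Set.Icc (-1 / 2 : ℝ) (3 / 2) →
      ‖riemannZeta₁ s‖ ≤ C * ‖s + 1‖ * (1 + |s.im|) ^ (1 - (s.re + 1 / 2) / 2) := by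
  obtain ⟨C₁, hC₁⟩ := exists_norm_riemannZeta₁_le_exp
  obtain ⟨A₀, hA₀, hA⟩ := exists_norm_riemannZeta_neg_half_le
  obtain ⟨B₀, hB⟩ := exists_norm_riemannZeta_le_of_re_ge (σ := 3 / 2) (by norm_num)
  have hB₀ : 0 ≤ B₀ := (norm_nonneg _).trans (hB 2 (by norm_num))
  set A : ℝ := 1 + 6 * A₀ * Real.exp (1 / 4) with hAdef
  set B : ℝ := 1 + B₀ * Real.exp (9 / 4) with hBdef
  have hA1 : 1 ≤ A := by have : 0 ≤ 6 * A₀ * Real.exp (1 / 4) := by positivity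
                         linarith
  have hB1 : 1 ≤ B := by have : 0 ≤ B₀ * Real.exp (9 / 4) := by positivity
                         linarith
  refine ⟨A * B, by positivity, fun s hs => ?_⟩
  set T : ℝ := s.im with hT
  have hne : ∀ z : ℂ, -1 / 2 ≤ z.re → 1 / 2 ≤ ‖z + 1‖ := fun z hz => by
    refine le_trans ?_ ((le_abs_self _).trans (Complex.abs_re_le_norm _))
    simp; linarith
  have hne0 : ∀ z : ℂ, -1 / 2 ≤ z.re → z + 1 ≠ 0 := fun z hz h => by
    have := hne z hz; rw [h, norm_zero] at this; norm_num at this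
  let g : ℂ → ℂ := fun z => riemannZeta₁ z / (z + 1) * Complex.exp ((z - Complex.I * T) ^ 2)
  have hgn : ∀ z, ‖g z‖ =
      ‖riemannZeta₁ z‖ / ‖z + 1‖ * Real.exp (z.re ^ 2 - (z.im - T) ^ 2) := fun z => by
    simp only [g, norm_mul, norm_div, Complex.norm_exp]
    congr 2
    rw [sq, Complex.mul_re]
    simp
    ring
  have hgd : ∀ z : ℂ, -1 / 2 ≤ z.re → DifferentiableAt ℂ g z := fun z hz =>
    ((differentiable_riemannZeta₁ z).div (differentiableAt_id.add_const 1) (hne0 z hz)).mul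
      (((differentiableAt_id.sub_const _).pow 2).cexp)
  have hd : DiffContOnCl ℂ g (verticalStrip (-1 / 2) (3 / 2)) := by
    refine ⟨fun z hz => (hgd z hz.1.le).differentiableWithinAt, fun z hz => ?_⟩
    have hz' : z ∈ verticalClosedStrip (-1 / 2) (3 / 2) := by
      refine closure_minimal ?_ (isClosed_Icc.preimage Complex.continuous_re) hz
      exact fun w hw => ⟨hw.1.le, hw.2.le⟩
    exact (hgd z hz'.1).continuousAt.continuousWithinAt
  have hbdd : BddAbove ((norm ∘ g) '' verticalClosedStrip (-1 / 2) (3 / 2)) := by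
    refine ⟨2 * |C₁| * Real.exp (17 / 2 + 5 * |T|), ?_⟩
    rintro _ ⟨z, hz, rfl⟩
    rw [Function.comp, hgn]
    have h1 : |z.im| ≤ |T| + |z.im - T| := by
      have := abs_add_le T (z.im - T); simpa using this
    have h2 : z.re ^ 2 ≤ 9 / 4 := by nlinarith [hz.1, hz.2]
    have h3 : 5 * |z.im| + (z.re ^ 2 - (z.im - T) ^ 2) ≤ 17 / 2 + 5 * |T| := by
      rw [← sq_abs (z.im - T)]
      nlinarith [sq_nonneg (|z.im - T| - 5 / 2)]
    have h4 := hne z hz.1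
    calc ‖riemannZeta₁ z‖ / ‖z + 1‖ * Real.exp (z.re ^ 2 - (z.im - T) ^ 2)
        ≤ (|C₁| * Real.exp (5 * |z.im|)) / (1 / 2) * Real.exp (z.re ^ 2 - (z.im - T) ^ 2) := by
          gcongr
          exact (hC₁ z hz).trans (by gcongr; exact le_abs_self _)
      _ = 2 * |C₁| * (Real.exp (5 * |z.im|) * Real.exp (z.re ^ 2 - (z.im - T) ^ 2)) := by ring
      _ ≤ _ := by rw [← Real.exp_add]; gcongr
  have hleft : ∀ z ∈ Complex.re ⁻¹' {(-1 / 2 : ℝ)}, ‖g z‖ ≤ A * (1 + |T|) := by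
    intro z hz
    have hz' : z.re = -1 / 2 := hz
    have hz1 : z ≠ 1 := by rintro rfl; norm_num at hz'
    have hpos : 0 < ‖z + 1‖ := lt_of_lt_of_le (by norm_num) (hne z hz'.ge)
    have h3 : ‖z - 1‖ ≤ 3 * ‖z + 1‖ := by
      rw [← abs_of_nonneg (norm_nonneg (z - 1)), ← abs_of_nonneg (by positivity : 0 ≤ 3 * ‖z + 1‖),
        ← sq_le_sq, mul_pow, ← Complex.normSq_eq_norm_sq, ← Complex.normSq_eq_norm_sq,
        Complex.normSq_apply, Complex.normSq_apply]
      simp [hz']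
      nlinarith [sq_nonneg z.im]
    have h1 : |z.im| ≤ |T| + |z.im - T| := by
      have := abs_add_le T (z.im - T); simpa using this
    have h5 : (1 + |z.im|) * Real.exp (-(z.im - T) ^ 2) ≤ 2 * (1 + |T|) := by
      rw [← sq_abs (z.im - T)]
      set x := |z.im - T| with hx
      have hx0 : 0 ≤ x := abs_nonneg _
      have e1 : Real.exp (-x ^ 2) * (1 + x) ≤ 2 := by
        have e2 : (1 + x ^ 2) * Real.exp (-x ^ 2) ≤ 1 := by
          rw [Real.exp_neg, ← div_eq_mul_inv, div_le_one (Real.exp_pos _)]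
          linarith [Real.add_one_le_exp (x ^ 2)]
        have e3 : 1 + x ≤ 2 * (1 + x ^ 2) := by nlinarith [sq_nonneg (x - 1 / 2)]
        calc Real.exp (-x ^ 2) * (1 + x) ≤ Real.exp (-x ^ 2) * (2 * (1 + x ^ 2)) := by gcongr
          _ ≤ 2 := by linarith
      calc (1 + |z.im|) * Real.exp (-x ^ 2)
          ≤ ((1 + |T|) * (1 + x)) * Real.exp (-x ^ 2) := by
            gcongr
            nlinarith [abs_nonneg T]
        _ = (1 + |T|) * (Real.exp (-x ^ 2) * (1 + x)) := by ring
        _ ≤ (1 + |T|) * 2 := by gcongr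
        _ = _ := by ring
    rw [hgn, riemannZeta₁_eq_mul hz1, norm_mul]
    calc ‖z - 1‖ * ‖riemannZeta z‖ / ‖z + 1‖ * Real.exp (z.re ^ 2 - (z.im - T) ^ 2)
        ≤ (3 * ‖z + 1‖) * (A₀ * (1 + |z.im|)) / ‖z + 1‖ *
            Real.exp (z.re ^ 2 - (z.im - T) ^ 2) := by
          gcongr
          exact hA z hz'
      _ = 3 * A₀ * Real.exp (1 / 4) * ((1 + |z.im|) * Real.exp (-(z.im - T) ^ 2)) := by
          rw [hz', sub_eq_add_neg, Real.exp_add]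
          field_simp
          norm_num
      _ ≤ 3 * A₀ * Real.exp (1 / 4) * (2 * (1 + |T|)) := by gcongr
      _ = (6 * A₀ * Real.exp (1 / 4)) * (1 + |T|) := by ring
      _ ≤ _ := by gcongr; linarith
  have hright : ∀ z ∈ Complex.re ⁻¹' {(3 / 2 : ℝ)}, ‖g z‖ ≤ B := by
    intro z hz
    have hz' : z.re = 3 / 2 := hz
    have hz1 : z ≠ 1 := by rintro rfl; norm_num at hz'
    have hpos : 0 < ‖z + 1‖ := lt_of_lt_of_le (by norm_num) (hne z (by linarith))
    have h3 : ‖z - 1‖ ≤ ‖z + 1‖ := by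
      rw [← abs_of_nonneg (norm_nonneg (z - 1)), ← abs_of_nonneg (norm_nonneg (z + 1)),
        ← sq_le_sq, ← Complex.normSq_eq_norm_sq, ← Complex.normSq_eq_norm_sq,
        Complex.normSq_apply, Complex.normSq_apply]
      simp [hz']
      norm_num
    rw [hgn, riemannZeta₁_eq_mul hz1, norm_mul]
    calc ‖z - 1‖ * ‖riemannZeta z‖ / ‖z + 1‖ * Real.exp (z.re ^ 2 - (z.im - T) ^ 2)
        ≤ ‖z + 1‖ * B₀ / ‖z + 1‖ * Real.exp (9 / 4) := by
          gcongr
          · exact hB z hz'.ge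
          · rw [hz']; nlinarith [sq_nonneg (z.im - T)]
      _ = B₀ * Real.exp (9 / 4) := by field_simp
      _ ≤ B := by linarith
  have hmain := norm_le_interp_of_mem_verticalClosedStrip' (z := s) (by norm_num) hs hd hbdd
    hleft hright
  rw [hgn, ← hT, sub_self, zero_pow two_ne_zero, sub_zero,
    show (3 / 2 - -1 / 2 : ℝ) = 2 by norm_num,
    show s.re - -1 / 2 = s.re + 1 / 2 by ring] at hmain
  have hpos : 0 < ‖s + 1‖ := lt_of_lt_of_le (by norm_num) (hne s hs.1)
  set θ : ℝ := (s.re + 1 / 2) / 2 with hθ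
  have hθ0 : 0 ≤ θ := by have := hs.1; rw [hθ]; linarith
  have hθ1 : θ ≤ 1 := by have := hs.2; rw [hθ]; linarith
  have hT0 : (0 : ℝ) ≤ 1 + |T| := by positivity
  calc ‖riemannZeta₁ s‖ = ‖s + 1‖ * (‖riemannZeta₁ s‖ / ‖s + 1‖ * 1) := by field_simp
    _ ≤ ‖s + 1‖ * (‖riemannZeta₁ s‖ / ‖s + 1‖ * Real.exp (s.re ^ 2)) := by
      gcongr
      exact Real.one_le_exp (by positivity)
    _ ≤ ‖s + 1‖ * ((A * (1 + |T|)) ^ (1 - θ) * B ^ θ) := by gcongr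
    _ ≤ ‖s + 1‖ * ((A * (1 + |T|) ^ (1 - θ)) * B) := by
      rw [Real.mul_rpow (by linarith) hT0]
      gcongr
      · exact Real.rpow_le_self_of_one_le hA1 (by linarith)
      · exact Real.rpow_le_self_of_one_le hB1 hθ1
    _ = _ := by ring

/-- On `σ ≤ re s`, `σ > -1/2`, the regular part of `ζ` grows more slowly than `|im s|`. -/
lemma exists_norm_riemannZeta₀_le_rpow {σ : ℝ} (hσ : -1 / 2 < σ) :
    ∃ a C : ℝ, 0 < a ∧ a < 1 ∧ 0 ≤ C ∧ ∀ s : ℂ, σ ≤ s.re → ‖riemannZeta₀ s‖ ≤ C * (1 + |s.im|) ^ a := by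
  wlog hσ0 : σ ≤ 0 generalizing σ
  · obtain ⟨a, C, h1, h2, h3, h4⟩ := this (σ := 0) (by norm_num) le_rfl
    exact ⟨a, C, h1, h2, h3, fun s hs => h4 s (by linarith)⟩
  obtain ⟨C₁, hC₁, h₁⟩ := exists_norm_riemannZeta₁_le_rpow
  obtain ⟨B, hB⟩ := exists_norm_riemannZeta_le_of_re_ge (σ := 3 / 2) (by norm_num)
  have hB0 : 0 ≤ B := (norm_nonneg _).trans (hB 2 (by norm_num))
  obtain ⟨M, hM⟩ := ((isCompact_Icc (a := σ) (b := 3 / 2)).reProdIm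
    (isCompact_Icc (a := (-1 : ℝ)) (b := 1))).exists_bound_of_continuousOn
    (f := riemannZeta₀) differentiable_riemannZeta₀.continuous.continuousOn
  set a : ℝ := 1 - (σ + 1 / 2) / 2 with ha
  have ha0 : 0 < a := by rw [ha]; linarith
  refine ⟨a, max (B + 2) (max |M| (3 * C₁ + 1)), ha0, by rw [ha]; linarith, by positivity, fun s hs => ?_⟩
  have hone : 1 ≤ (1 + |s.im|) ^ a := Real.one_le_rpow (by linarith [abs_nonneg s.im]) ha0.le
  rcases le_total (3 / 2) s.re with hre | hre
  · have hs1 : s ≠ 1 := by rintro rfl; norm_num at hre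
    have hd : 1 / 2 ≤ ‖s - 1‖ := by
      refine le_trans ?_ ((le_abs_self _).trans (Complex.abs_re_le_norm _))
      simp; linarith
    have h0 : riemannZeta₀ s = riemannZeta s - (s - 1)⁻¹ := by
      rw [riemannZeta_eq_inv_sub_add hs1]; ring
    calc ‖riemannZeta₀ s‖ ≤ ‖riemannZeta s‖ + ‖(s - 1)⁻¹‖ := by rw [h0]; exact norm_sub_le _ _
      _ ≤ B + 2 := by
        gcongr
        · exact hB s hre
        · rw [norm_inv, show (2 : ℝ) = (1 / 2)⁻¹ by norm_num]
          gcongr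
      _ ≤ (B + 2) * (1 + |s.im|) ^ a := le_mul_of_one_le_right (by positivity) hone
      _ ≤ _ := by gcongr; exact le_max_left _ _
  rcases le_total |s.im| 1 with him | him
  · calc ‖riemannZeta₀ s‖ ≤ |M| := (hM s ⟨⟨hs, hre⟩, abs_le.1 him⟩).trans (le_abs_self _)
      _ ≤ |M| * (1 + |s.im|) ^ a := le_mul_of_one_le_right (abs_nonneg _) hone
      _ ≤ _ := by gcongr; exact (le_max_left _ _).trans (le_max_right _ _)
  · have h1 : 1 ≤ ‖s - 1‖ := by
      refine le_trans ?_ (Complex.abs_im_le_norm _)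
      simpa using him
    have h2 : ‖s + 1‖ ≤ 3 * ‖s - 1‖ := by
      calc ‖s + 1‖ = ‖(s - 1) + 2‖ := by ring_nf
        _ ≤ ‖s - 1‖ + ‖(2 : ℂ)‖ := norm_add_le _ _
        _ ≤ _ := by rw [Complex.norm_ofNat]; linarith
    have h3 : ‖s - 1‖ * ‖riemannZeta₀ s‖ ≤ ‖riemannZeta₁ s‖ + 1 := by
      have : (s - 1) * riemannZeta₀ s = riemannZeta₁ s - 1 := by rw [riemannZeta₁]; ring
      rw [← norm_mul, this]
      simpa using norm_sub_le (riemannZeta₁ s) 1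
    have h4 : ‖riemannZeta₁ s‖ ≤ C₁ * (3 * ‖s - 1‖) * (1 + |s.im|) ^ a := by
      refine (h₁ s ⟨by linarith, hre⟩).trans ?_
      gcongr
      · linarith [abs_nonneg s.im]
      · rw [ha]; linarith
    have h5 : ‖s - 1‖ * ‖riemannZeta₀ s‖ ≤ ‖s - 1‖ * ((3 * C₁ + 1) * (1 + |s.im|) ^ a) := by
      nlinarith [mul_le_mul h1 hone zero_le_one (norm_nonneg _)]
    calc ‖riemannZeta₀ s‖ ≤ (3 * C₁ + 1) * (1 + |s.im|) ^ a := le_of_mul_le_mul_left h5 (by linarith)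
      _ ≤ _ := by gcongr; exact (le_max_right _ _).trans (le_max_right _ _)

lemma exists_norm_iteratedDeriv_riemannZeta₀_le_rpow {σ : ℝ} (hσ : -1 / 2 < σ) (k : ℕ) :
    ∃ a C : ℝ, 0 < a ∧ a < 1 ∧ 0 ≤ C ∧
      ∀ s : ℂ, σ ≤ s.re → ‖iteratedDeriv k riemannZeta₀ s‖ ≤ C * (1 + |s.im|) ^ a := by
  obtain ⟨a, C, ha0, ha1, hC, h⟩ := exists_norm_riemannZeta₀_le_rpow
    (σ := (σ - 1 / 2) / 2) (by linarith)
  set r : ℝ := (σ + 1 / 2) / 2 with hr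
  have hr0 : 0 < r := by rw [hr]; linarith
  refine ⟨a, k.factorial * (C * (1 + r) ^ a) / r ^ k, ha0, ha1, by positivity, fun s hs => ?_⟩
  refine (Complex.norm_iteratedDeriv_le_of_forall_mem_sphere_norm_le (n := k)
    (C := C * ((1 + r) ^ a * (1 + |s.im|) ^ a)) hr0
    differentiable_riemannZeta₀.diffContOnCl fun z hz => ?_).trans (le_of_eq (by ring))
  have hz' : ‖z - s‖ = r := by simpa [dist_eq_norm] using hz
  have h1 : |z.re - s.re| ≤ r := by simpa [hz'] using Complex.abs_re_le_norm (z - s)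
  have h2 : |z.im - s.im| ≤ r := by simpa [hz'] using Complex.abs_im_le_norm (z - s)
  refine (h z ?_).trans ?_
  · have := (abs_le.1 h1).1; rw [hr] at this; linarith
  · rw [← Real.mul_rpow (by positivity) (by positivity)]
    gcongr
    have h3 : |z.im| ≤ |s.im| + |z.im - s.im| := by
      have := abs_add_le s.im (z.im - s.im); simpa using this
    nlinarith [abs_nonneg s.im]

lemma exists_one_add_abs_sq_le {α : ℝ} (hα : 0 < α) (β : ℝ) :
    ∃ K, 0 < K ∧ ∀ τ : ℝ, (1 + |τ|) ^ 2 ≤ K * (α ^ 2 + (τ - β) ^ 2) := by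
  refine ⟨2 * (1 + |β|) ^ 2 / α ^ 2 + 2, by positivity, fun τ => ?_⟩
  have h1 : |τ| ≤ |β| + |τ - β| := by have := abs_add_le β (τ - β); simpa using this
  have h2 : (1 + |τ|) ^ 2 ≤ 2 * (1 + |β|) ^ 2 + 2 * (τ - β) ^ 2 := by
    rw [← sq_abs (τ - β)]
    nlinarith [sq_nonneg (1 + |β| - |τ - β|), abs_nonneg τ, abs_nonneg β, abs_nonneg (τ - β)]
  refine h2.trans ?_
  have h3 : 2 * (1 + |β|) ^ 2 / α ^ 2 * α ^ 2 = 2 * (1 + |β|) ^ 2 := by field_simp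
  have h4 : 0 ≤ 2 * (1 + |β|) ^ 2 / α ^ 2 * (τ - β) ^ 2 := by positivity
  nlinarith [sq_nonneg α]

lemma integrable_div_quadratic {α : ℝ} (hα : 0 < α) (β : ℝ) {h : ℝ → ℂ} (hc : Continuous h)
    {a C : ℝ} (ha : a < 1) (hC : 0 ≤ C) (hb : ∀ τ, ‖h τ‖ ≤ C * (1 + |τ|) ^ a) :
    Integrable (fun τ : ℝ => h τ / ((α ^ 2 + (τ - β) ^ 2 : ℝ) : ℂ)) := by
  obtain ⟨K, hK, hKb⟩ := exists_one_add_abs_sq_le hα β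
  have hpos : ∀ τ : ℝ, 0 < α ^ 2 + (τ - β) ^ 2 := fun τ => by positivity
  have hint : Integrable (fun τ : ℝ => (C * K) * (1 + ‖τ‖) ^ (-(2 - a))) :=
    (integrable_one_add_norm (by simp; linarith)).const_mul _
  refine hint.mono' ?_ (Eventually.of_forall fun τ => ?_)
  · refine (hc.div (by fun_prop) fun τ => ?_).aestronglyMeasurable
    exact_mod_cast (hpos τ).ne'
  · rw [norm_div, Complex.norm_real, Real.norm_of_nonneg (hpos τ).le, div_le_iff₀ (hpos τ)]
    refine (hb τ).trans ?_
    have h1 : 0 < 1 + |τ| := by positivity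
    have h2 : (1 + |τ|) ^ a = (1 + |τ|) ^ (-(2 - a)) * (1 + |τ|) ^ 2 := by
      rw [← Real.rpow_natCast, ← Real.rpow_add h1]
      congr 1; push_cast; ring
    rw [h2, Real.norm_eq_abs]
    calc C * ((1 + |τ|) ^ (-(2 - a)) * (1 + |τ|) ^ 2)
        ≤ C * ((1 + |τ|) ^ (-(2 - a)) * (K * (α ^ 2 + (τ - β) ^ 2))) := by
          gcongr
          exact hKb τ
      _ = _ := by ring

lemma cauchyPDFReal_toNNReal {α : ℝ} (hα : 0 < α) (β τ : ℝ) :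
    cauchyPDFReal β α.toNNReal τ = α / Real.pi * (α ^ 2 + (τ - β) ^ 2)⁻¹ := by
  rw [cauchyPDFReal_def, Real.coe_toNNReal _ hα.le]
  ring_nf

lemma integral_inv_quadratic {α : ℝ} (hα : 0 < α) (β : ℝ) :
    ∫ τ : ℝ, (α ^ 2 + (τ - β) ^ 2)⁻¹ = Real.pi / α := by
  have h := integral_cauchyPDFReal_eq_one β (γ := α.toNNReal) (by simpa using hα)
  simp_rw [cauchyPDFReal_toNNReal hα] at h
  rw [integral_const_mul] at h
  have := Real.pi_pos
  field_simp at h ⊢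
  linarith

lemma tendsto_rpow_div_atTop {a : ℝ} (ha0 : 0 < a) (ha : a < 1) (C G : ℝ) :
    Tendsto (fun R : ℝ => 16 * (C * (1 + 2 * R) ^ a + G) / R) atTop (𝓝 0) := by
  have h1 : Tendsto (fun R : ℝ => (1 + 2 * R) ^ (-(1 - a))) atTop (𝓝 0) :=
    (tendsto_rpow_neg_atTop (by linarith)).comp
      (tendsto_atTop_add_const_left _ _ (tendsto_id.const_mul_atTop two_pos))
  have h2 : Tendsto (fun R : ℝ => R⁻¹) atTop (𝓝 0) := tendsto_inv_atTop_zero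
  have h3 := (((h1.mul ((h2.add_const 2))).const_mul C).add (h2.const_mul G)).const_mul 16
  simp only [zero_mul, mul_zero, add_zero] at h3
  refine h3.congr' ?_
  filter_upwards [eventually_gt_atTop 0] with R hR
  have hp : (0 : ℝ) < 1 + 2 * R := by linarith
  have : (1 + 2 * R) ^ a = (1 + 2 * R) ^ (-(1 - a)) * (1 + 2 * R) := by
    rw [← Real.rpow_add_one hp.ne']
    congr 1; ring
  rw [this]
  field_simp

/-- **Poisson formula** for the right half-plane. -/
lemma poisson_right_halfPlane {g : ℂ → ℂ} {δ : ℝ} (hδ : 0 < δ)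
    (hg : DifferentiableOn ℂ g {u | -δ < u.re}) {a C : ℝ} (ha0 : 0 < a) (ha : a < 1) (hC : 0 ≤ C)
    (hb : ∀ u : ℂ, 0 ≤ u.re → ‖g u‖ ≤ C * (1 + ‖u‖) ^ a) {α : ℝ} (hα : 0 < α) (β : ℝ) :
    Integrable (fun τ : ℝ => g (Complex.I * τ) / ((α ^ 2 + (τ - β) ^ 2 : ℝ) : ℂ)) ∧
    ((α / Real.pi : ℝ) : ℂ) * ∫ τ : ℝ, g (Complex.I * τ) / ((α ^ 2 + (τ - β) ^ 2 : ℝ) : ℂ) =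
      g (α + Complex.I * β) := by
  set U : Set ℂ := {u | -δ < u.re} with hU
  have hUo : IsOpen U := isOpen_re_gt _
  set z₀ : ℂ := α + Complex.I * β with hz₀
  set z₁ : ℂ := -α + Complex.I * β with hz₁
  have hz₀U : z₀ ∈ U := by simp [hU, hz₀]; linarith
  have hIU : ∀ τ : ℝ, Complex.I * τ ∈ U := fun τ => by simpa [hU] using hδ
  have hpos : ∀ τ : ℝ, 0 < α ^ 2 + (τ - β) ^ 2 := fun τ => by positivity
  have hgc : Continuous fun τ : ℝ => g (Complex.I * τ) :=
    hg.continuousOn.comp_continuous (by fun_prop) hIU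
  have hgb : ∀ τ : ℝ, ‖g (Complex.I * τ)‖ ≤ C * (1 + |τ|) ^ a := fun τ => by
    simpa using hb (Complex.I * τ) (by simp)
  have hint := integrable_div_quadratic hα β hgc ha hC hgb
  refine ⟨hint, ?_⟩
  have hint₀ : Integrable (fun τ : ℝ => g z₀ / ((α ^ 2 + (τ - β) ^ 2 : ℝ) : ℂ)) :=
    integrable_div_quadratic hα β continuous_const ha (norm_nonneg (g z₀)) fun τ =>
      le_mul_of_one_le_right (norm_nonneg _)
        (Real.one_le_rpow (by linarith [abs_nonneg τ]) ha0.le)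
  let F : ℂ → ℂ := fun u => dslope g z₀ u / (u - z₁)
  have hFd : DifferentiableOn ℂ F {u | 0 ≤ u.re} := by
    have h1 : DifferentiableOn ℂ (dslope g z₀) U :=
      (Complex.differentiableOn_dslope (hUo.mem_nhds hz₀U)).2 hg
    refine (h1.mono fun u (hu : 0 ≤ u.re) => by simp [hU]; linarith).div (by fun_prop)
      fun u (hu : 0 ≤ u.re) h => ?_
    have := congrArg Complex.re h
    simp [hz₁] at this
    linarith
  have hFI : ∀ τ : ℝ, F (τ * Complex.I) =
      g z₀ / ((α ^ 2 + (τ - β) ^ 2 : ℝ) : ℂ) -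
        g (Complex.I * τ) / ((α ^ 2 + (τ - β) ^ 2 : ℝ) : ℂ) := by
    intro τ
    have hne : (τ * Complex.I : ℂ) ≠ z₀ := fun h => by
      have := congrArg Complex.re h; simp [hz₀] at this; linarith
    have h3 : ((τ : ℂ) * Complex.I - z₀) * (τ * Complex.I - z₁) =
        -((α ^ 2 + (τ - β) ^ 2 : ℝ) : ℂ) := by
      rw [hz₀, hz₁]; push_cast
      linear_combination ((τ : ℂ) - β) ^ 2 * Complex.I_sq
    have h5 : ((α ^ 2 + (τ - β) ^ 2 : ℝ) : ℂ) ≠ 0 := by exact_mod_cast (hpos τ).ne'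
    simp only [F]
    rw [dslope_of_ne _ hne, slope_def_field, div_div, h3, mul_comm (τ : ℂ) Complex.I, div_neg,
      ← sub_div, ← neg_div]
    ring
  have hlim : Tendsto (fun R : ℝ => ∫ y in -R..R, F (y * Complex.I)) atTop (𝓝 0) := by
    refine squeeze_zero_norm' ?_ (tendsto_rpow_div_atTop ha0 ha C ‖g z₀‖)
    filter_upwards [eventually_ge_atTop (2 * ‖z₀‖ + 1)] with R hR
    have hR0 : 0 < R := by linarith [norm_nonneg z₀]
    have hz₁n : ‖z₁‖ = ‖z₀‖ := by
      rw [← sq_eq_sq₀ (norm_nonneg _) (norm_nonneg _), ← Complex.normSq_eq_norm_sq,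
        ← Complex.normSq_eq_norm_sq, Complex.normSq_apply, Complex.normSq_apply]
      simp [hz₀, hz₁]
    set D : ℝ := 4 * (C * (1 + 2 * R) ^ a + ‖g z₀‖) / R ^ 2 with hD
    have hFb : ∀ u : ℂ, 0 ≤ u.re → R ≤ ‖u‖ → ‖u‖ ≤ 2 * R → ‖F u‖ ≤ D := by
      intro u hu hu1 hu2
      have hne : u ≠ z₀ := by
        rintro rfl; linarith [norm_nonneg z₀]
      have h1 : R / 2 ≤ ‖u - z₀‖ := by have := norm_sub_norm_le u z₀; linarith
      have h2 : R / 2 ≤ ‖u - z₁‖ := by have := norm_sub_norm_le u z₁; linarith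
      have h3 : ‖g u - g z₀‖ ≤ C * (1 + 2 * R) ^ a + ‖g z₀‖ := by
        refine (norm_sub_le _ _).trans ?_
        gcongr
        refine (hb u hu).trans ?_
        gcongr
      simp only [F]
      rw [dslope_of_ne _ hne, slope_def_field, norm_div, norm_div, div_div]
      calc ‖g u - g z₀‖ / (‖u - z₀‖ * ‖u - z₁‖)
          ≤ (C * (1 + 2 * R) ^ a + ‖g z₀‖) / (R / 2 * (R / 2)) := by gcongr
        _ = D := by rw [hD]; field_simp; ring
    have hrect := Complex.integral_boundary_rect_eq_zero_of_differentiableOn F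
      (⟨0, -R⟩ : ℂ) (⟨R, R⟩ : ℂ) (hFd.mono fun u hu => by
        have := hu.1
        simp only [Set.uIcc_of_le hR0.le] at this
        exact this.1)
    simp only [Complex.ofReal_zero, zero_add] at hrect
    have hD0 : 0 ≤ D := by positivity
    have b1 : ‖∫ x in (0 : ℝ)..R, F (x + ((-R : ℝ) : ℂ) * Complex.I)‖ ≤ D * R := by
      have := intervalIntegral.norm_integral_le_of_norm_le_const (a := 0) (b := R) (C := D)
        (f := fun x : ℝ => F (x + ((-R : ℝ) : ℂ) * Complex.I)) fun x hx => by
          rw [Set.uIoc_of_le hR0.le] at hx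
          refine hFb _ (by simp; exact hx.1.le) ?_ ?_
          · refine le_trans ?_ (Complex.abs_im_le_norm _)
            simp; exact le_abs_self _
          · refine (Complex.norm_le_abs_re_add_abs_im _).trans ?_
            simp [abs_of_pos hR0, abs_of_pos hx.1]; linarith [hx.2]
      rwa [sub_zero, abs_of_pos hR0] at this
    have b2 : ‖∫ x in (0 : ℝ)..R, F (x + (R : ℂ) * Complex.I)‖ ≤ D * R := by
      have := intervalIntegral.norm_integral_le_of_norm_le_const (a := 0) (b := R) (C := D)
        (f := fun x : ℝ => F (x + (R : ℂ) * Complex.I)) fun x hx => by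
          rw [Set.uIoc_of_le hR0.le] at hx
          refine hFb _ (by simp; exact hx.1.le) ?_ ?_
          · refine le_trans ?_ (Complex.abs_im_le_norm _)
            simp; exact le_abs_self _
          · refine (Complex.norm_le_abs_re_add_abs_im _).trans ?_
            simp [abs_of_pos hR0, abs_of_pos hx.1]; linarith [hx.2]
      rwa [sub_zero, abs_of_pos hR0] at this
    have b3 : ‖∫ y in (-R)..R, F (R + y * Complex.I)‖ ≤ D * (2 * R) := by
      have := intervalIntegral.norm_integral_le_of_norm_le_const (a := -R) (b := R) (C := D)
        (f := fun y : ℝ => F (R + y * Complex.I)) fun y hy => by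
          rw [Set.uIoc_of_le (by linarith)] at hy
          refine hFb _ (by simp; exact hR0.le) ?_ ?_
          · refine le_trans ?_ (Complex.abs_re_le_norm _)
            simp; exact le_abs_self _
          · refine (Complex.norm_le_abs_re_add_abs_im _).trans ?_
            have : |y| ≤ R := abs_le.2 ⟨hy.1.le, hy.2⟩
            simp [abs_of_pos hR0]; linarith
      rwa [sub_neg_eq_add, abs_of_pos (by linarith), ← two_mul] at this
    have e : Complex.I • (∫ y in -R..R, F (y * Complex.I)) =
        (∫ x in (0 : ℝ)..R, F (x + ((-R : ℝ) : ℂ) * Complex.I)) -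
        (∫ x in (0 : ℝ)..R, F (x + (R : ℂ) * Complex.I)) +
        Complex.I • ∫ y in (-R)..R, F (R + y * Complex.I) := (sub_eq_zero.1 hrect).symm
    have e2 : ‖∫ y in -R..R, F (y * Complex.I)‖ =
        ‖Complex.I • (∫ y in -R..R, F (y * Complex.I))‖ := by
      rw [norm_smul, Complex.norm_I, one_mul]
    rw [e2, e]
    refine (norm_add_le _ _).trans ?_
    rw [norm_smul, Complex.norm_I, one_mul]
    calc _ ≤ (D * R + D * R) + D * (2 * R) := by
          gcongr
          exact (norm_sub_le _ _).trans (by gcongr)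
      _ = _ := by rw [hD]; field_simp; ring
  have hlim2 : Tendsto (fun R : ℝ => ∫ y in -R..R, F (y * Complex.I)) atTop
      (𝓝 (∫ y : ℝ, F (y * Complex.I))) := by
    refine intervalIntegral_tendsto_integral ?_ tendsto_neg_atTop_atBot tendsto_id
    simp_rw [hFI]
    exact hint₀.sub hint
  have hzero := tendsto_nhds_unique hlim2 hlim
  simp_rw [hFI] at hzero
  rw [integral_sub hint₀ hint, sub_eq_zero] at hzero
  rw [← hzero]
  have e3 : ∀ τ : ℝ, g z₀ / ((α ^ 2 + (τ - β) ^ 2 : ℝ) : ℂ) =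
      g z₀ * (((α ^ 2 + (τ - β) ^ 2)⁻¹ : ℝ) : ℂ) := fun τ => by
    rw [Complex.ofReal_inv, div_eq_mul_inv]
  simp_rw [e3]
  rw [integral_const_mul, integral_complex_ofReal, integral_inv_quadratic hα]
  have := Real.pi_pos.ne'
  push_cast
  have h1 : (Real.pi : ℂ) ≠ 0 := by exact_mod_cast this
  have h2 : (α : ℂ) ≠ 0 := by exact_mod_cast hα.ne'
  field_simp

/-- **Poisson formula** for the left half-plane. -/
lemma poisson_left_halfPlane {g : ℂ → ℂ} {δ : ℝ} (hδ : 0 < δ)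
    (hg : DifferentiableOn ℂ g {u | u.re < δ}) {a C : ℝ} (ha0 : 0 < a) (ha : a < 1) (hC : 0 ≤ C)
    (hb : ∀ u : ℂ, u.re ≤ 0 → ‖g u‖ ≤ C * (1 + ‖u‖) ^ a) {α : ℝ} (hα : 0 < α) (β : ℝ) :
    Integrable (fun τ : ℝ => g (Complex.I * τ) / ((α ^ 2 + (τ - β) ^ 2 : ℝ) : ℂ)) ∧
    ((α / Real.pi : ℝ) : ℂ) * ∫ τ : ℝ, g (Complex.I * τ) / ((α ^ 2 + (τ - β) ^ 2 : ℝ) : ℂ) =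
      g (-α + Complex.I * β) := by
  have h := poisson_right_halfPlane (g := fun u => g (-u)) hδ
    (hg.comp differentiable_neg.differentiableOn fun u (hu : -δ < u.re) => by
      simp; linarith) ha0 ha hC (fun u hu => by simpa using hb (-u) (by simpa using hu)) hα (-β)
  have e : ∀ τ : ℝ, g (-(Complex.I * ((-τ : ℝ) : ℂ))) / ((α ^ 2 + (-τ - -β) ^ 2 : ℝ) : ℂ) =
      g (Complex.I * τ) / ((α ^ 2 + (τ - β) ^ 2 : ℝ) : ℂ) := fun τ => by
    rw [show -τ - -β = -(τ - β) by ring, neg_sq]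
    simp
  refine ⟨?_, ?_⟩
  · have := h.1.comp_neg
    simpa only [e] using this
  · rw [← integral_neg_eq_self] at h
    simp only [e] at h
    rw [h.2]
    congr 1
    push_cast; ring

/-- The `k`-th derivative of the polar part `(z - 1)⁻¹` of `ζ`. -/
noncomputable def zetaPoleDeriv (k : ℕ) (z : ℂ) : ℂ := (-1) ^ k * k.factorial / (z - 1) ^ (k + 1)

lemma iteratedDeriv_inv_sub (k : ℕ) : iteratedDeriv k (fun z : ℂ => (z - 1)⁻¹) = zetaPoleDeriv k := by
  have h := iter_deriv_inv_linear_sub k (1 : ℂ) 1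
  simp only [one_mul, one_pow, mul_one] at h
  rw [iteratedDeriv_eq_iterate, h]
  funext z
  rw [zetaPoleDeriv, show (-1 - k : ℤ) = -((k + 1 : ℕ) : ℤ) by push_cast; ring, zpow_neg,
    zpow_natCast, div_eq_mul_inv]

lemma zetaDeriv_eq_add (k : ℕ) {z : ℂ} (hz : z ≠ 1) :
    zetaDeriv k z = iteratedDeriv k riemannZeta₀ z + zetaPoleDeriv k z := by
  have h : riemannZeta =ᶠ[𝓝 z] fun z => riemannZeta₀ z + (z - 1)⁻¹ := by
    filter_upwards [isOpen_ne.mem_nhds hz] with w hw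
    rw [riemannZeta_eq_inv_sub_add hw, add_comm]
  have h2 : AnalyticAt ℂ (fun z : ℂ => (z - 1)⁻¹) z :=
    (analyticAt_id.sub analyticAt_const).inv (sub_ne_zero.2 hz)
  rw [zetaDeriv, h.iteratedDeriv_eq, iteratedDeriv_fun_add
    differentiable_riemannZeta₀.contDiff.contDiffAt h2.contDiffAt, iteratedDeriv_inv_sub]

lemma poleCorrection_eq_sub {α β : ℝ} (k : ℕ) (s : ℂ) :
    poleCorrection α β k s =
      zetaPoleDeriv k (s - α + Complex.I * β) - zetaPoleDeriv k (s + α + Complex.I * β) := by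
  have e1 : (Complex.I * (β + Complex.I * α - Complex.I * (s - 1)) : ℂ) =
      s - α + Complex.I * β - 1 := by linear_combination (α - (s - 1)) * Complex.I_sq
  have e2 : (Complex.I * (β - Complex.I * α - Complex.I * (s - 1)) : ℂ) =
      s + α + Complex.I * β - 1 := by linear_combination (-α - (s - 1)) * Complex.I_sq
  rw [zetaPoleDeriv, zetaPoleDeriv, ← e1, ← e2, mul_pow, mul_pow, poleCorrection]
  simp only [div_eq_mul_inv, mul_inv, one_mul]
  ring

lemma differentiableAt_zetaPoleDeriv (k : ℕ) {z : ℂ} (hz : z ≠ 1) :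
    DifferentiableAt ℂ (zetaPoleDeriv k) z :=
  (differentiableAt_const _).div ((differentiableAt_id.sub_const 1).pow _)
    (pow_ne_zero _ (sub_ne_zero.2 hz))

lemma norm_zetaPoleDeriv_le (k : ℕ) {d : ℝ} (hd : 0 < d) {z : ℂ} (hz : d ≤ |z.re - 1|) :
    ‖zetaPoleDeriv k z‖ ≤ k.factorial / d ^ (k + 1) := by
  have : d ≤ ‖z - 1‖ := hz.trans (by simpa using Complex.abs_re_le_norm (z - 1))
  rw [zetaPoleDeriv, norm_div, norm_mul, norm_pow, norm_pow, norm_neg, norm_one, one_pow, one_mul,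
    Complex.norm_natCast]
  gcongr

lemma le_mul_one_add_rpow {x c y a : ℝ} (hc : 0 ≤ c) (hx : x ≤ c) (hy : 0 ≤ y) (ha : 0 ≤ a) :
    x ≤ c * (1 + y) ^ a :=
  hx.trans (le_mul_of_one_le_right hc (Real.one_le_rpow (by linarith) ha))

/-- Growth of `ζ^{(k)}` on a vertical line. -/
lemma exists_norm_zetaDeriv_le_rpow (k : ℕ) {s : ℂ} (hs : -1 / 2 < s.re) (hs1 : s.re ≠ 1) :
    ∃ a C : ℝ, 0 < a ∧ a < 1 ∧ 0 ≤ C ∧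
      ∀ τ : ℝ, ‖zetaDeriv k (s + Complex.I * τ)‖ ≤ C * (1 + |τ|) ^ a := by
  obtain ⟨a, C, ha0, ha1, hC, h⟩ := exists_norm_iteratedDeriv_riemannZeta₀_le_rpow hs k
  have hd : 0 < |s.re - 1| := abs_pos.2 (sub_ne_zero.2 hs1)
  refine ⟨a, C * (1 + |s.im|) ^ a + k.factorial / |s.re - 1| ^ (k + 1), ha0, ha1, by positivity,
    fun τ => ?_⟩
  have hre : (s + Complex.I * τ).re = s.re := by simp
  have hne : s + Complex.I * τ ≠ 1 := fun e => hs1 (by rw [← hre, e, Complex.one_re])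
  rw [zetaDeriv_eq_add k hne, add_mul]
  refine (norm_add_le _ _).trans (add_le_add ((h _ hre.ge).trans ?_) ?_)
  · rw [mul_assoc, ← Real.mul_rpow (by positivity) (by positivity)]
    have him : (s + Complex.I * τ).im = s.im + τ := by simp
    rw [him]
    gcongr
    nlinarith [abs_add_le s.im τ, abs_nonneg s.im, abs_nonneg τ,
      mul_nonneg (abs_nonneg s.im) (abs_nonneg τ)]
  · exact le_mul_one_add_rpow (by positivity) (norm_zetaPoleDeriv_le k hd (by rw [hre]))
      (abs_nonneg _) ha0.le

lemma continuous_zetaDeriv_vertical (k : ℕ) {s : ℂ} (hs1 : s.re ≠ 1) :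
    Continuous fun τ : ℝ => zetaDeriv k (s + Complex.I * τ) := by
  have hne : ∀ τ : ℝ, s + Complex.I * τ ≠ 1 := fun τ e => hs1 (by
    have := congrArg Complex.re e; simpa using this)
  rw [funext fun τ : ℝ => zetaDeriv_eq_add k (hne τ)]
  refine ((differentiable_riemannZeta₀.iteratedDeriv_complex k).continuous.comp (by fun_prop)).add ?_
  rw [continuous_iff_continuousAt]
  intro τ
  exact ContinuousAt.comp (g := zetaPoleDeriv k)
    (differentiableAt_zetaPoleDeriv k (hne τ)).continuousAt (by fun_prop)

lemma integrable_zetaCauchyIntegrand {α : ℝ} (hα : 0 < α) (β : ℝ) (k : ℕ) {s : ℂ}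
    (hs : -1 / 2 < s.re) (hs1 : s.re ≠ 1) : Integrable (zetaCauchyIntegrand α β k s) := by
  obtain ⟨a, C, -, ha1, hC, h⟩ := exists_norm_zetaDeriv_le_rpow k hs hs1
  exact integrable_div_quadratic hα β (continuous_zetaDeriv_vertical k hs1) ha1 hC h

lemma poisson_iteratedDeriv_riemannZeta₀ {α : ℝ} (hα : 0 < α) (β : ℝ) (k : ℕ) {s : ℂ}
    (hs : -1 / 2 < s.re) :
    Integrable (fun τ : ℝ => iteratedDeriv k riemannZeta₀ (s + Complex.I * τ) /
      ((α ^ 2 + (τ - β) ^ 2 : ℝ) : ℂ)) ∧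
    ((α / Real.pi : ℝ) : ℂ) * ∫ τ : ℝ, iteratedDeriv k riemannZeta₀ (s + Complex.I * τ) /
      ((α ^ 2 + (τ - β) ^ 2 : ℝ) : ℂ) =
      iteratedDeriv k riemannZeta₀ (s + α + Complex.I * β) := by
  obtain ⟨a, C, ha0, ha1, hC, h⟩ := exists_norm_iteratedDeriv_riemannZeta₀_le_rpow hs k
  rw [add_assoc s]
  refine poisson_right_halfPlane (g := fun u => iteratedDeriv k riemannZeta₀ (s + u)) one_pos
    (((differentiable_riemannZeta₀.iteratedDeriv_complex k).comp
      (differentiable_id.const_add s)).differentiableOn) (a := a) (C := C * (1 + ‖s‖) ^ a)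
    ha0 ha1 (by positivity) (fun u hu => (h _ (by simpa using hu)).trans ?_) hα β
  rw [mul_assoc, ← Real.mul_rpow (by positivity) (by positivity)]
  gcongr
  have := (Complex.abs_im_le_norm (s + u)).trans (norm_add_le s u)
  nlinarith [mul_nonneg (norm_nonneg s) (norm_nonneg u)]

lemma zetaCauchyIntegral_eq_add {α : ℝ} (hα : 0 < α) (β : ℝ) (k : ℕ) {s : ℂ}
    (hs : -1 / 2 < s.re) (hs1 : s.re ≠ 1) {w : ℂ}
    (hw : Integrable (fun τ : ℝ => zetaPoleDeriv k (s + Complex.I * τ) /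
        ((α ^ 2 + (τ - β) ^ 2 : ℝ) : ℂ)) ∧
      ((α / Real.pi : ℝ) : ℂ) * ∫ τ : ℝ, zetaPoleDeriv k (s + Complex.I * τ) /
        ((α ^ 2 + (τ - β) ^ 2 : ℝ) : ℂ) = w) :
    zetaCauchyIntegral α β k s = iteratedDeriv k riemannZeta₀ (s + α + Complex.I * β) + w := by
  have h0 := poisson_iteratedDeriv_riemannZeta₀ hα β k hs
  have hne : ∀ τ : ℝ, s + Complex.I * τ ≠ 1 := fun τ e => hs1 (by
    have := congrArg Complex.re e; simpa using this)
  rw [zetaCauchyIntegral, ← h0.2, ← hw.2, ← mul_add, ← integral_add h0.1 hw.1]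
  congr 2
  funext τ
  rw [zetaCauchyIntegrand, zetaDeriv_eq_add k (hne τ), add_div]

lemma zetaCauchyIntegral_of_one_lt_re {α : ℝ} (hα : 0 < α) (β : ℝ) (k : ℕ) {s : ℂ}
    (hs : 1 < s.re) :
    zetaCauchyIntegral α β k s = zetaDeriv k (s + α + Complex.I * β) := by
  have hne : s + α + Complex.I * β ≠ 1 := fun e => by
    have := congrArg Complex.re e; simp at this; linarith
  rw [zetaDeriv_eq_add k hne]
  refine zetaCauchyIntegral_eq_add hα β k (by linarith) hs.ne' ?_
  rw [add_assoc s]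
  have hd : 0 < s.re - 1 := by linarith
  refine poisson_right_halfPlane (g := fun u => zetaPoleDeriv k (s + u)) hd
    (fun u (hu : _ < u.re) => ?_) (a := 1 / 2) (C := k.factorial / (s.re - 1) ^ (k + 1))
    (by norm_num) (by norm_num) (by positivity) (fun u hu => ?_) hα β
  · have : s + u ≠ 1 := fun e => by
      have := congrArg Complex.re e; simp at this; linarith
    exact ((differentiableAt_zetaPoleDeriv k this).comp u
      (differentiableAt_id.const_add s)).differentiableWithinAt
  · refine le_mul_one_add_rpow (by positivity) (norm_zetaPoleDeriv_le k hd ?_) (norm_nonneg u)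
      (by norm_num)
    rw [Complex.add_re]
    exact le_trans (by linarith) (le_abs_self _)

lemma zetaCauchyIntegral_of_re_lt_one {α : ℝ} (hα : 0 < α) (β : ℝ) (k : ℕ) {s : ℂ}
    (hs : -1 / 2 < s.re) (hs1 : s.re < 1) :
    zetaCauchyIntegral α β k s = iteratedDeriv k riemannZeta₀ (s + α + Complex.I * β) +
      zetaPoleDeriv k (s - α + Complex.I * β) := by
  refine zetaCauchyIntegral_eq_add hα β k hs hs1.ne ?_
  have e : s - α + Complex.I * β = s + (-α + Complex.I * β) := by ring
  rw [e]
  have hd : 0 < 1 - s.re := by linarith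
  refine poisson_left_halfPlane (g := fun u => zetaPoleDeriv k (s + u)) hd
    (fun u (hu : u.re < _) => ?_) (a := 1 / 2) (C := k.factorial / (1 - s.re) ^ (k + 1))
    (by norm_num) (by norm_num) (by positivity) (fun u hu => ?_) hα β
  · have : s + u ≠ 1 := fun e => by
      have := congrArg Complex.re e; simp at this; linarith
    exact ((differentiableAt_zetaPoleDeriv k this).comp u
      (differentiableAt_id.const_add s)).differentiableWithinAt
  · refine le_mul_one_add_rpow (by positivity) (norm_zetaPoleDeriv_le k hd ?_) (norm_nonneg u)
      (by norm_num)
    rw [Complex.add_re, abs_sub_comm]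
    exact le_trans (by linarith) (le_abs_self _)

lemma zetaCauchyIntegral_eq_zetaDeriv_add_poleCorrection {α : ℝ} (hα : 0 < α) (β : ℝ) (k : ℕ)
    {s : ℂ} (hs : -1 / 2 < s.re) (hs1 : s.re < 1) (hne : s ≠ 1 - α - Complex.I * β) :
    zetaCauchyIntegral α β k s =
      zetaDeriv k (s + α + Complex.I * β) + poleCorrection α β k s := by
  have hne' : s + α + Complex.I * β ≠ 1 := fun e => hne (by rw [← e]; ring)
  rw [zetaCauchyIntegral_of_re_lt_one hα β k hs hs1, zetaDeriv_eq_add k hne', poleCorrection_eq_sub]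
  ring

lemma zetaCauchyIntegral_eq_stieltjes {α : ℝ} (hα : 0 < α) (β : ℝ) (k : ℕ)
    {s : ℂ} (hs : -1 / 2 < s.re) (hs1 : s.re < 1) (h : s = 1 - α - Complex.I * β) :
    zetaCauchyIntegral α β k s =
      (-1) ^ k * (stieltjesConstant k : ℂ) - (k.factorial : ℂ) / (2 * (α : ℂ)) ^ (k + 1) := by
  have e1 : s + α + Complex.I * β = 1 := by rw [h]; ring
  have e2 : s - α + Complex.I * β - 1 = -(2 * α) := by rw [h]; ring
  have e3 : ((-1 : ℂ) ^ k) * (-1) ^ k = 1 := by rw [← mul_pow]; simp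
  rw [zetaCauchyIntegral_of_re_lt_one hα β k hs hs1, e1, iteratedDeriv_riemannZeta₀_one,
    zetaPoleDeriv, e2, neg_pow (2 * (α : ℂ)), sub_eq_add_neg, pow_succ (-1 : ℂ)]
  congr 1
  have : (2 * (α : ℂ)) ^ (k + 1) ≠ 0 := pow_ne_zero _ (by
    have : (α : ℂ) ≠ 0 := by exact_mod_cast hα.ne'
    simpa using this)
  have h4 : (-1 : ℂ) ^ k ≠ 0 := pow_ne_zero _ (by norm_num)
  field_simp

/-- The map `θ ↦ β - α cot (πθ)` from the circle to the line. -/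
noncomputable def cauchyCot (α β : ℝ) : UnitAddCircle → ℝ :=
  Function.Periodic.lift (f := fun x : ℝ => β - α * Real.cot (Real.pi * x)) (c := 1) fun x => by
    simp only [Real.cot_eq_cos_div_sin, mul_add, mul_one, Real.cos_add_pi, Real.sin_add_pi,
      neg_div_neg_eq]

lemma cauchyCot_coe (α β x : ℝ) :
    cauchyCot α β (x : UnitAddCircle) = β - α * Real.cot (Real.pi * x) := rfl

lemma cot_two_mul (x : ℝ) : Real.cot (2 * x) = (Real.cot x - (Real.cot x)⁻¹) / 2 := by
  rw [Real.cot_eq_cos_div_sin, Real.cot_eq_cos_div_sin, Real.cos_two_mul', Real.sin_two_mul]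
  by_cases hs : Real.sin x = 0
  · simp [hs]
  by_cases hc : Real.cos x = 0
  · simp [hc]
  field_simp

lemma booleMap_cauchyCot {α : ℝ} (hα : 0 < α) (β : ℝ) (θ : UnitAddCircle) :
    booleMap α β (cauchyCot α β θ) = cauchyCot α β ((2 : ℕ) • θ) := by
  induction θ using QuotientAddGroup.induction_on with
  | H x =>
    change booleMap α β (cauchyCot α β (x : UnitAddCircle)) =
      cauchyCot α β ((2 : ℕ) • (x : UnitAddCircle))
    rw [← AddCircle.coe_nsmul, cauchyCot_coe, cauchyCot_coe, booleMap, nsmul_eq_mul, Nat.cast_ofNat,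
      show Real.pi * (2 * x) = 2 * (Real.pi * x) by ring, cot_two_mul]
    by_cases hc : Real.cot (Real.pi * x) = 0
    · simp [hc]
    · rw [if_neg (by simpa [hα.ne'] using hc)]
      field_simp
      ring

lemma booleMap_iterate_cauchyCot {α : ℝ} (hα : 0 < α) (β : ℝ) (n : ℕ) (θ : UnitAddCircle) :
    (booleMap α β)^[n] (cauchyCot α β θ) = cauchyCot α β ((2 ^ n : ℕ) • θ) := by
  induction n with
  | zero => simp
  | succ n ih =>
    rw [Function.iterate_succ_apply', ih, booleMap_cauchyCot hα, ← mul_nsmul', pow_succ, mul_comm]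

lemma measurable_cot : Measurable Real.cot := by
  rw [funext Real.cot_eq_cos_div_sin]
  exact Real.measurable_cos.div Real.measurable_sin

lemma measurable_cauchyCot (α β : ℝ) : Measurable (cauchyCot α β) := by
  intro s hs
  have h := measurable_cot
  have h1 : Measurable fun x : ℝ => β - α * Real.cot (Real.pi * x) := by
    exact measurable_const.sub ((h.comp (measurable_const.mul measurable_id)).const_mul α)
  exact h1 hs

lemma map_cauchyCot {α : ℝ} (hα : 0 < α) (β : ℝ) :
    Measure.map (cauchyCot α β) volume = cauchyMeasure β α.toNNReal := by
  ext E hE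
  have hpi := Real.pi_pos
  let φ : ℝ → ℝ := fun x => 1 / 2 + Real.arctan ((x - β) / α) / Real.pi
  have hφd : ∀ x, HasDerivAt φ (cauchyPDFReal β α.toNNReal x) x := by
    intro x
    have h := (((((hasDerivAt_id x).sub_const β).div_const α).arctan).div_const Real.pi).const_add
      (1 / 2)
    refine h.congr_deriv ?_
    rw [cauchyPDFReal_toNNReal hα]
    simp only [id]
    have : α ^ 2 + (x - β) ^ 2 ≠ 0 := by positivity
    field_simp
  have hφm : Monotone φ := by
    intro x y hxy
    have : Real.arctan ((x - β) / α) ≤ Real.arctan ((y - β) / α) :=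
      Real.arctan_strictMono.monotone (by gcongr)
    simp only [φ]
    gcongr
  have hcot : ∀ x, β - α * Real.cot (Real.pi * φ x) = x := by
    intro x
    have e : Real.pi * φ x = Real.pi / 2 - -Real.arctan ((x - β) / α) := by
      simp only [φ]; field_simp; ring
    rw [e, ← Real.tan_inv_eq_cot, Real.tan_pi_div_two_sub, inv_inv, Real.tan_neg,
      Real.tan_arctan]
    field_simp
    ring
  have himg : φ '' E = (fun x : ℝ => β - α * Real.cot (Real.pi * x)) ⁻¹' E ∩ Set.Ioo 0 1 := by
    ext y
    constructor
    · rintro ⟨x, hx, rfl⟩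
      refine ⟨by simpa [hcot] using hx, ?_, ?_⟩
      · have := Real.neg_pi_div_two_lt_arctan ((x - β) / α)
        have h2 : -(1 / 2) < Real.arctan ((x - β) / α) / Real.pi := by
          rw [lt_div_iff₀ hpi]; linarith
        simp only [φ]; linarith
      · have := Real.arctan_lt_pi_div_two ((x - β) / α)
        have h2 : Real.arctan ((x - β) / α) / Real.pi < 1 / 2 := by
          rw [div_lt_iff₀ hpi]; linarith
        simp only [φ]; linarith
    · rintro ⟨hy, hy0, hy1⟩
      refine ⟨_, hy, ?_⟩
      have e : (β - α * Real.cot (Real.pi * y) - β) / α = Real.tan (Real.pi * y - Real.pi / 2) := by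
        rw [show Real.pi * y - Real.pi / 2 = -(Real.pi / 2 - Real.pi * y) by ring, Real.tan_neg,
          Real.tan_pi_div_two_sub, Real.tan_inv_eq_cot]
        field_simp
        ring
      simp only [φ]
      rw [e, Real.arctan_tan (by nlinarith) (by nlinarith)]
      field_simp
      ring
  have h1 : volume (φ '' E) = cauchyMeasure β α.toNNReal E := by
    rw [← lintegral_deriv_eq_volume_image_of_monotoneOn hE
      (fun x _ => (hφd x).hasDerivWithinAt) (hφm.monotoneOn E),
      cauchyMeasure_of_scale_ne_zero β (by simpa using hα), withDensity_apply _ hE]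
    rfl
  rw [← h1, himg, Measure.map_apply (measurable_cauchyCot α β) hE,
    AddCircle.add_projection_respects_measure 1 0 (measurable_cauchyCot α β hE), zero_add]
  refine measure_congr ?_
  exact (Filter.EventuallyEq.refl _ _).inter Ioo_ae_eq_Ioc.symm

lemma ae_of_ae_cauchyMeasure {α : ℝ} (hα : 0 < α) {β : ℝ} {P : ℝ → Prop}
    (h : ∀ᵐ x ∂(cauchyMeasure β α.toNNReal), P x) : ∀ᵐ x : ℝ, P x := by
  have hne : α.toNNReal ≠ 0 := by simpa using hα
  rw [cauchyMeasure_of_scale_ne_zero β hne,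
    ae_withDensity_iff (measurable_cauchyPDF _ _)] at h
  filter_upwards [h] with x hx
  refine hx ?_
  rw [cauchyPDF_def]
  simpa using cauchyPDF_pos β hne x

lemma abs_cot_le (x : ℝ) (hx : 0 < ‖(x : UnitAddCircle)‖) :
    |Real.cot (Real.pi * x)| ≤ 1 / (2 * ‖(x : UnitAddCircle)‖) := by
  have hpi := Real.pi_pos
  set y : ℝ := x - round x with hy
  have hn : ‖(x : UnitAddCircle)‖ = |y| := UnitAddCircle.norm_eq
  have hcot : Real.cot (Real.pi * x) = Real.cot (Real.pi * y) := by
    have hp : Function.Periodic (fun x : ℝ => Real.cot (Real.pi * x)) 1 := fun x => by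
      simp only [Real.cot_eq_cos_div_sin, mul_add, mul_one, Real.cos_add_pi, Real.sin_add_pi,
        neg_div_neg_eq]
    have := hp.sub_int_mul_eq (x := x) (round x)
    simp only [mul_one] at this
    exact this.symm
  rw [hn] at hx ⊢
  have hy2 : |y| ≤ 1 / 2 := abs_sub_round x
  have hsin : 2 * |y| ≤ |Real.sin (Real.pi * y)| := by
    have h := Real.mul_abs_le_abs_sin (x := Real.pi * y) (by
      rw [abs_mul, abs_of_pos hpi]; nlinarith)
    rw [abs_mul, abs_of_pos hpi] at h
    calc 2 * |y| = 2 / Real.pi * (Real.pi * |y|) := by field_simp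
      _ ≤ _ := h
  rw [hcot, Real.cot_eq_cos_div_sin, abs_div]
  gcongr
  exact Real.abs_cos_le_one _

lemma abs_cauchyCot_le {α : ℝ} (hα : 0 < α) (β : ℝ) {θ : UnitAddCircle} (hθ : 0 < ‖θ‖) :
    |cauchyCot α β θ| ≤ |β| + α / (2 * ‖θ‖) := by
  induction θ using QuotientAddGroup.induction_on with
  | H x =>
    change |cauchyCot α β (x : UnitAddCircle)| ≤ |β| + α / (2 * ‖(x : UnitAddCircle)‖)
    rw [cauchyCot_coe]
    refine (abs_sub _ _).trans ?_
    rw [abs_mul, abs_of_pos hα, div_eq_mul_one_div α]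
    gcongr
    exact abs_cot_le x hθ

instance : IsProbabilityMeasure (volume : Measure UnitAddCircle) := ⟨UnitAddCircle.measure_univ⟩

lemma measurePreserving_two_pow_nsmul (d : ℕ) :
    MeasurePreserving (fun x : UnitAddCircle => (2 ^ d : ℕ) • x) volume volume := by
  rcases Nat.eq_zero_or_pos d with rfl | hd
  · simp only [pow_zero, one_smul]
    exact MeasurePreserving.id volume
  · exact (AddCircle.ergodic_nsmul (Nat.one_lt_two_pow hd.ne')).toMeasurePreserving

/-- Average of `g` along the orbit `2 ^ κ n • x` of the doubling map. -/
noncomputable def doublingAverage (κ : ℕ → ℕ) (g : UnitAddCircle → ℂ) (N : ℕ) (x : UnitAddCircle) :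
    ℂ :=
  (N : ℂ)⁻¹ * ∑ n ∈ Finset.range N, g ((2 ^ κ n : ℕ) • x)

/-- `L¹` distance of the average of `g` to the mean of `g`. -/
noncomputable def doublingDeviation (κ : ℕ → ℕ) (g : UnitAddCircle → ℂ) (N : ℕ) : ℝ :=
  ∫ x, ‖doublingAverage κ g N x - ∫ y, g y‖

lemma integrable_comp_two_pow {g : UnitAddCircle → ℂ} (hg : Integrable g) (d : ℕ) :
    Integrable fun x : UnitAddCircle => g ((2 ^ d : ℕ) • x) :=
  (measurePreserving_two_pow_nsmul d).integrable_comp_of_integrable hg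

lemma integral_comp_two_pow {E : Type*} [NormedAddCommGroup E] [NormedSpace ℝ E]
    {g : UnitAddCircle → E} (hg : AEStronglyMeasurable g volume)
    (d : ℕ) : ∫ x : UnitAddCircle, g ((2 ^ d : ℕ) • x) = ∫ x, g x := by
  have h := measurePreserving_two_pow_nsmul d
  rw [← integral_map h.measurable.aemeasurable (by rwa [h.map_eq]), h.map_eq]

lemma integrable_doublingAverage (κ : ℕ → ℕ) {g : UnitAddCircle → ℂ} (hg : Integrable g) (N : ℕ) :
    Integrable (doublingAverage κ g N) :=
  (integrable_finsetSum _ fun n _ => integrable_comp_two_pow hg (κ n)).const_mul _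

lemma doublingAverage_add (κ : ℕ → ℕ) (g h : UnitAddCircle → ℂ) (N : ℕ) (x : UnitAddCircle) :
    doublingAverage κ (g + h) N x = doublingAverage κ g N x + doublingAverage κ h N x := by
  simp only [doublingAverage, Pi.add_apply, Finset.sum_add_distrib, mul_add]

lemma norm_doublingAverage_le (κ : ℕ → ℕ) (g : UnitAddCircle → ℂ) (N : ℕ) (x : UnitAddCircle) :
    ‖doublingAverage κ g N x‖ ≤ (N : ℝ)⁻¹ * ∑ n ∈ Finset.range N, ‖g ((2 ^ κ n : ℕ) • x)‖ := by
  rw [doublingAverage, norm_mul, norm_inv, Complex.norm_natCast]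
  gcongr
  exact norm_sum_le _ _

lemma integral_norm_doublingAverage_le (κ : ℕ → ℕ) {g : UnitAddCircle → ℂ} (hg : Integrable g)
    (N : ℕ) : ∫ x, ‖doublingAverage κ g N x‖ ≤ ∫ x, ‖g x‖ := by
  have hint : ∀ n, Integrable fun x : UnitAddCircle => ‖g ((2 ^ κ n : ℕ) • x)‖ := fun n =>
    (integrable_comp_two_pow hg (κ n)).norm
  calc ∫ x, ‖doublingAverage κ g N x‖
      ≤ ∫ x, (N : ℝ)⁻¹ * ∑ n ∈ Finset.range N, ‖g ((2 ^ κ n : ℕ) • x)‖ :=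
        integral_mono (integrable_doublingAverage κ hg N).norm
          ((integrable_finsetSum _ fun n _ => hint n).const_mul _)
          (norm_doublingAverage_le κ g N)
    _ = (N : ℝ)⁻¹ * (N * ∫ x, ‖g x‖) := by
        rw [integral_const_mul, integral_finsetSum _ fun n _ => hint n]
        simp_rw [fun n => integral_comp_two_pow hg.1.norm (κ n)]
        simp
    _ ≤ ∫ x, ‖g x‖ := by
        rw [← mul_assoc]
        exact mul_le_of_le_one_left (by positivity) (inv_mul_le_one)

lemma doublingDeviation_nonneg (κ : ℕ → ℕ) (g : UnitAddCircle → ℂ) (N : ℕ) :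
    0 ≤ doublingDeviation κ g N := integral_nonneg fun _ => norm_nonneg _

lemma integrable_deviation (κ : ℕ → ℕ) {g : UnitAddCircle → ℂ} (hg : Integrable g) (N : ℕ) :
    Integrable fun x => ‖doublingAverage κ g N x - ∫ y, g y‖ :=
  ((integrable_doublingAverage κ hg N).sub (integrable_const _)).norm

lemma doublingDeviation_add_le (κ : ℕ → ℕ) {g h : UnitAddCircle → ℂ} (hg : Integrable g)
    (hh : Integrable h) (N : ℕ) :
    doublingDeviation κ (g + h) N ≤ doublingDeviation κ g N + doublingDeviation κ h N := by
  rw [doublingDeviation, doublingDeviation, doublingDeviation,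
    ← integral_add (integrable_deviation κ hg N) (integrable_deviation κ hh N)]
  refine integral_mono (integrable_deviation κ (hg.add hh) N)
    ((integrable_deviation κ hg N).add (integrable_deviation κ hh N)) fun x => ?_
  simp only [doublingAverage_add]
  rw [show ∫ y, (g + h) y = (∫ y, g y) + ∫ y, h y from integral_add hg hh, add_sub_add_comm]
  exact norm_add_le _ _

lemma doublingDeviation_le_two_mul (κ : ℕ → ℕ) {g : UnitAddCircle → ℂ} (hg : Integrable g) (N : ℕ) :
    doublingDeviation κ g N ≤ 2 * ∫ x, ‖g x‖ := by
  have h1 := (integrable_doublingAverage κ hg N).norm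
  calc doublingDeviation κ g N ≤ ∫ x, (‖doublingAverage κ g N x‖ + ‖∫ y, g y‖) :=
        integral_mono (integrable_deviation κ hg N) (h1.add (integrable_const _))
          fun x => norm_sub_le _ _
    _ = (∫ x, ‖doublingAverage κ g N x‖) + ‖∫ y, g y‖ := by
        rw [integral_add h1 (integrable_const _)]; simp
    _ ≤ (∫ x, ‖g x‖) + ∫ x, ‖g x‖ :=
        add_le_add (integral_norm_doublingAverage_le κ hg N) (norm_integral_le_integral_norm _)
    _ = _ := by ring

lemma doublingDeviation_const_smul (κ : ℕ → ℕ) (c : ℂ) (g : UnitAddCircle → ℂ) (N : ℕ) :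
    doublingDeviation κ (c • g) N = ‖c‖ * doublingDeviation κ g N := by
  rw [doublingDeviation, doublingDeviation, ← integral_const_mul]
  congr 1
  funext x
  have h1 : doublingAverage κ (c • g) N x = c * doublingAverage κ g N x := by
    simp only [doublingAverage, Pi.smul_apply, smul_eq_mul, ← Finset.mul_sum]
    ring
  have h2 : ∫ y, (c • g) y = c * ∫ y, g y := integral_const_mul c g
  rw [h1, h2, ← mul_sub, norm_mul]

lemma tendsto_doublingDeviation_of_approx (κ : ℕ → ℕ) {g : UnitAddCircle → ℂ} (hg : Integrable g)
    (h : ∀ ε > 0, ∃ f : UnitAddCircle → ℂ, Integrable f ∧ (∫ x, ‖g x - f x‖) ≤ ε ∧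
      Tendsto (doublingDeviation κ f) atTop (𝓝 0)) :
    Tendsto (doublingDeviation κ g) atTop (𝓝 0) := by
  rw [Metric.tendsto_atTop]
  intro ε hε
  obtain ⟨f, hf, hfg, hlim⟩ := h (ε / 4) (by linarith)
  obtain ⟨N₀, hN₀⟩ := Metric.tendsto_atTop.1 hlim (ε / 2) (by linarith)
  refine ⟨N₀, fun N hN => ?_⟩
  have h1 := hN₀ N hN
  rw [Real.dist_0_eq_abs, abs_of_nonneg (doublingDeviation_nonneg _ _ _)] at h1 ⊢
  have h2 := doublingDeviation_add_le κ (hg.sub hf) hf N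
  have h3 := doublingDeviation_le_two_mul κ (hg.sub hf) N
  rw [sub_add_cancel] at h2
  simp only [Pi.sub_apply] at h3
  linarith

lemma integral_fourier (m : ℤ) :
    ∫ x : UnitAddCircle, fourier m x = if m = 0 then 1 else 0 := by
  have h := congrFun (fourierCoeff_fourier (T := 1) m) 0
  rw [fourierCoeff, AddCircle.integral_haarAddCircle] at h
  simp only [neg_zero, fourier_zero, one_smul, inv_one] at h
  rw [h]
  by_cases hm : m = 0
  · subst hm; simp
  · simp [hm, Ne.symm hm]

/-- Coincidences `κ n = κ m` have density zero for a uniformly distributed `κ`. -/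
lemma tendsto_card_coincidences {κ : ℕ → ℕ} (hκ : IsUniformlyDistributedInt κ) :
    Tendsto (fun N : ℕ => (((Finset.range N ×ˢ Finset.range N).filter
      fun p => κ p.1 = κ p.2).card : ℝ) / (N : ℝ) ^ 2) atTop (𝓝 0) := by
  rw [Metric.tendsto_atTop]
  intro ε hε
  obtain ⟨m, hm⟩ := exists_nat_gt (2 / ε + 1)
  have hm1 : 1 < m := by
    have : (1 : ℝ) < m := by have := div_pos two_pos hε; linarith
    exact_mod_cast this
  have hm0 : (0 : ℝ) < m := by positivity
  have hev : ∀ᶠ N : ℕ in atTop, ∀ r ∈ Finset.range m,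
      (((Finset.range N).filter (fun n => κ n ≡ r [MOD m])).card : ℝ) / N < 2 / m := by
    rw [Filter.eventually_all_finset]
    intro r _
    refine (hκ m hm1 r).eventually_lt_const ?_
    gcongr
    norm_num
  obtain ⟨N₀, hN₀⟩ := eventually_atTop.1 (hev.and (eventually_gt_atTop 0))
  refine ⟨N₀, fun N hN => ?_⟩
  obtain ⟨h1, hNpos⟩ := hN₀ N hN
  have hN0 : (0 : ℝ) < N := by exact_mod_cast hNpos
  rw [Real.dist_0_eq_abs, abs_of_nonneg (by positivity)]
  have hcard : ((Finset.range N ×ˢ Finset.range N).filter fun p => κ p.1 = κ p.2).card ≤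
      ∑ n ∈ Finset.range N, ((Finset.range N).filter fun n' => κ n' ≡ κ n % m [MOD m]).card := by
    rw [← Finset.card_sigma]
    refine Finset.card_le_card_of_injOn (fun p => ⟨p.1, p.2⟩) ?_ ?_
    · rintro ⟨a, b⟩ hp
      simp only [Finset.coe_filter, Finset.mem_product, Finset.mem_range, Set.mem_ofPred_eq] at hp
      simp only [Finset.coe_sigma, Set.mem_sigma_iff, Finset.mem_coe, Finset.mem_range,
        Finset.mem_filter]
      refine ⟨hp.1.1, hp.1.2, ?_⟩
      rw [hp.2]
      exact (Nat.mod_modEq _ _).symm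
    · rintro ⟨a, b⟩ _ ⟨c, d⟩ _ h
      simpa using h
  have hcard' : (((Finset.range N ×ˢ Finset.range N).filter fun p => κ p.1 = κ p.2).card : ℝ) ≤
      N * (2 / m * N) := by
    refine (Nat.cast_le.2 hcard).trans ?_
    push_cast
    refine (Finset.sum_le_card_nsmul (Finset.range N) _ (2 / (m : ℝ) * N) fun n _ => ?_).trans
      (le_of_eq (by rw [Finset.card_range, nsmul_eq_mul]))
    have := h1 (κ n % m) (Finset.mem_range.2 (Nat.mod_lt _ (by omega)))
    rw [div_lt_iff₀ hN0] at this
    exact this.le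
  have h2 : 2 / (m : ℝ) < ε := by
    rw [div_lt_iff₀ hm0]
    have : 2 / ε < m := by linarith
    rw [div_lt_iff₀ hε] at this
    linarith
  refine lt_of_le_of_lt ?_ h2
  rw [div_le_iff₀ (by positivity)]
  linarith [hcard']

lemma integral_norm_sq_doublingAverage_fourier (κ : ℕ → ℕ) {j : ℤ} (hj : j ≠ 0) (N : ℕ) :
    ∫ x, ‖doublingAverage κ (fourier j) N x‖ ^ 2 =
      (((Finset.range N ×ˢ Finset.range N).filter fun p => κ p.1 = κ p.2).card : ℝ) /
        (N : ℝ) ^ 2 := by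
  have hf : ∀ (n : ℕ) (x : UnitAddCircle),
      fourier j ((2 ^ κ n : ℕ) • x) = fourier (j * 2 ^ κ n) x := fun n x => by
    rw [fourier_apply, fourier_apply, mul_smul]
    rw [← natCast_zsmul]
    push_cast
    rfl
  have hpt : ∀ x, ((‖doublingAverage κ (fourier j) N x‖ ^ 2 : ℝ) : ℂ) =
      ((N : ℂ) ^ 2)⁻¹ * ∑ p ∈ Finset.range N ×ˢ Finset.range N,
        fourier (j * 2 ^ κ p.1 + -(j * 2 ^ κ p.2)) x := by
    intro x
    have h1 : (starRingEnd ℂ) (doublingAverage κ (fourier j) N x) =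
        (N : ℂ)⁻¹ * ∑ n ∈ Finset.range N, fourier (-(j * 2 ^ κ n)) x := by
      simp only [doublingAverage, map_mul, map_inv₀, map_sum, Complex.conj_natCast, hf, fourier_neg]
    rw [← Complex.normSq_eq_norm_sq, ← Complex.mul_conj, h1, doublingAverage,
      Finset.sum_product]
    simp only [hf, fourier_add, ← Finset.mul_sum, ← Finset.sum_mul]
    ring
  have hcont : ∀ m : ℤ, Integrable (fun x : UnitAddCircle => fourier m x) := fun m =>
    (map_continuous (fourier m)).integrable_of_hasCompactSupport (HasCompactSupport.of_compactSpace _)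
  have hC : ((∫ x, ‖doublingAverage κ (fourier j) N x‖ ^ 2 : ℝ) : ℂ) =
      (((((Finset.range N ×ˢ Finset.range N).filter fun p => κ p.1 = κ p.2).card : ℝ) /
        (N : ℝ) ^ 2 : ℝ) : ℂ) := by
    rw [← integral_complex_ofReal]
    simp_rw [hpt]
    rw [integral_const_mul, integral_finsetSum _ fun p _ => hcont _]
    simp_rw [integral_fourier]
    have hiff : ∀ p : ℕ × ℕ, j * 2 ^ κ p.1 + -(j * 2 ^ κ p.2) = 0 ↔ κ p.1 = κ p.2 := fun p => by
      rw [← sub_eq_add_neg, sub_eq_zero, mul_right_inj' hj]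
      exact (pow_right_injective₀ (a := (2 : ℤ)) (by norm_num) (by norm_num)).eq_iff
    simp_rw [hiff]
    rw [Finset.sum_boole]
    push_cast
    ring
  exact_mod_cast hC

lemma tendsto_doublingDeviation_fourier {κ : ℕ → ℕ} (hκ : IsUniformlyDistributedInt κ) (j : ℤ) :
    Tendsto (doublingDeviation κ (fourier j)) atTop (𝓝 0) := by
  by_cases hj : j = 0
  · subst hj
    refine tendsto_const_nhds.congr' ?_
    filter_upwards [eventually_gt_atTop 0] with N hN
    have : (N : ℂ) ≠ 0 := by exact_mod_cast hN.ne'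
    simp [doublingDeviation, doublingAverage, this]
  · have hdev : ∀ N, doublingDeviation κ (fourier j) N =
        ∫ x, ‖doublingAverage κ (fourier j) N x‖ := fun N => by
      rw [doublingDeviation, integral_fourier, if_neg hj]
      simp
    have hcont : ∀ N, Continuous (doublingAverage κ (fourier j) N) := fun N => by
      unfold doublingAverage
      fun_prop
    have hint : ∀ N, Integrable fun x => ‖doublingAverage κ (fourier j) N x‖ := fun N =>
      (hcont N).norm.integrable_of_hasCompactSupport (HasCompactSupport.of_compactSpace _)
    have hint2 : ∀ N, Integrable fun x => ‖doublingAverage κ (fourier j) N x‖ ^ 2 := fun N =>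
      ((hcont N).norm.pow 2).integrable_of_hasCompactSupport (HasCompactSupport.of_compactSpace _)
    rw [Metric.tendsto_atTop]
    intro ε hε
    obtain ⟨N₀, hN₀⟩ := Metric.tendsto_atTop.1 (tendsto_card_coincidences hκ) (ε ^ 2)
      (by positivity)
    refine ⟨N₀, fun N hN => ?_⟩
    have h1 := hN₀ N hN
    rw [← integral_norm_sq_doublingAverage_fourier κ hj, Real.dist_0_eq_abs,
      abs_of_nonneg (integral_nonneg fun _ => by positivity)] at h1
    rw [Real.dist_0_eq_abs, abs_of_nonneg (doublingDeviation_nonneg _ _ _), hdev]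
    have h2 : ∫ x, ‖doublingAverage κ (fourier j) N x‖ ≤
        ∫ x, (ε / 2 + (2 * ε)⁻¹ * ‖doublingAverage κ (fourier j) N x‖ ^ 2) := by
      refine integral_mono (hint N) ((integrable_const _).add ((hint2 N).const_mul _)) fun x => ?_
      set t := ‖doublingAverage κ (fourier j) N x‖
      have : ε / 2 + (2 * ε)⁻¹ * t ^ 2 - t = (2 * ε)⁻¹ * (t - ε) ^ 2 := by field_simp; ring
      have h3 : 0 ≤ (2 * ε)⁻¹ * (t - ε) ^ 2 := by positivity
      change t ≤ ε / 2 + (2 * ε)⁻¹ * t ^ 2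
      linarith
    rw [integral_add (integrable_const _) ((hint2 N).const_mul _), integral_const_mul] at h2
    simp only [integral_const, probReal_univ, one_smul] at h2
    have h3 : (2 * ε)⁻¹ * (∫ x, ‖doublingAverage κ (fourier j) N x‖ ^ 2) < (2 * ε)⁻¹ * ε ^ 2 := by
      gcongr
    have h4 : (2 * ε)⁻¹ * ε ^ 2 = ε / 2 := by field_simp
    linarith

lemma tendsto_doublingDeviation_continuousMap {κ : ℕ → ℕ} (hκ : IsUniformlyDistributedInt κ)
    (g : C(UnitAddCircle, ℂ)) : Tendsto (doublingDeviation κ g) atTop (𝓝 0) := by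
  have hint : ∀ g : C(UnitAddCircle, ℂ), Integrable (fun x => g x) := fun g =>
    (map_continuous g).integrable_of_hasCompactSupport (HasCompactSupport.of_compactSpace _)
  have hspan : ∀ f ∈ Submodule.span ℂ (Set.range (@fourier 1)),
      Tendsto (doublingDeviation κ f) atTop (𝓝 0) := by
    intro f hf
    induction hf using Submodule.span_induction with
    | mem f hf =>
      obtain ⟨j, rfl⟩ := hf
      exact tendsto_doublingDeviation_fourier hκ j
    | zero =>
      refine tendsto_const_nhds.congr fun N => ?_
      simp [doublingDeviation, doublingAverage]
    | add f g _ _ hf hg =>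
      refine squeeze_zero (fun N => doublingDeviation_nonneg _ _ _)
        (fun N => doublingDeviation_add_le κ (hint f) (hint g) N) ?_
      simpa using hf.add hg
    | smul c f _ hf =>
      refine (hf.const_mul ‖c‖).congr' (Eventually.of_forall fun N => ?_) |>.trans (by simp)
      exact (doublingDeviation_const_smul κ c f N).symm
  refine tendsto_doublingDeviation_of_approx κ (hint g) fun ε hε => ?_
  have hg : g ∈ closure ((Submodule.span ℂ (Set.range (@fourier 1)) :
      Submodule ℂ C(UnitAddCircle, ℂ)) : Set C(UnitAddCircle, ℂ)) := by
    have h := span_fourier_closure_eq_top (T := 1)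
    rw [← Submodule.topologicalClosure_coe, h]
    trivial
  obtain ⟨f, hf, hfg⟩ := Metric.mem_closure_iff.1 hg ε hε
  refine ⟨f, hint f, ?_, hspan f hf⟩
  calc ∫ x, ‖g x - f x‖ ≤ ∫ _x : UnitAddCircle, ε :=
        integral_mono ((hint g).sub (hint f)).norm (integrable_const _) fun x => by
          change ‖g x - f x‖ ≤ ε
          rw [← dist_eq_norm]
          exact (ContinuousMap.dist_apply_le_dist x).trans hfg.le
    _ = ε := by simp

/-- Mean ergodic theorem along `κ` for the doubling map. -/
lemma tendsto_doublingDeviation {κ : ℕ → ℕ} (hκ : IsUniformlyDistributedInt κ)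
    {g : UnitAddCircle → ℂ} (hg : Integrable g) :
    Tendsto (doublingDeviation κ g) atTop (𝓝 0) := by
  refine tendsto_doublingDeviation_of_approx κ hg fun ε hε => ?_
  obtain ⟨f, hf, hfi⟩ := hg.exists_boundedContinuous_integral_sub_le hε
  exact ⟨f, hfi, hf, tendsto_doublingDeviation_continuousMap hκ f.toContinuousMap⟩

/-- If the averages of an integrable function converge almost everywhere, then to its mean. -/
lemma ae_tendsto_doublingAverage_of_exists {κ : ℕ → ℕ} (hκ : IsUniformlyDistributedInt κ)
    {g : UnitAddCircle → ℂ} (hg : Integrable g)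
    (h : ∀ᵐ x, ∃ l, Tendsto (fun N => doublingAverage κ g N x) atTop (𝓝 l)) :
    ∀ᵐ x, Tendsto (fun N => doublingAverage κ g N x) atTop (𝓝 (∫ y, g y)) := by
  have hm : TendstoInMeasure volume (fun N => doublingAverage κ g N) atTop fun _ => ∫ y, g y := by
    refine tendstoInMeasure_of_tendsto_eLpNorm one_ne_zero
      (fun N => (integrable_doublingAverage κ hg N).1) aestronglyMeasurable_const ?_
    have h1 := (ENNReal.continuous_ofReal.tendsto 0).comp (tendsto_doublingDeviation hκ hg)
    rw [ENNReal.ofReal_zero] at h1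
    refine h1.congr fun N => ?_
    rw [eLpNorm_one_eq_lintegral_enorm]
    exact ofReal_integral_norm_eq_lintegral_enorm
      ((integrable_doublingAverage κ hg N).sub (integrable_const _))
  obtain ⟨ns, hns, hae⟩ := hm.exists_seq_tendsto_ae
  filter_upwards [h, hae] with x ⟨l, hl⟩ hx
  rwa [tendsto_nhds_unique hx (hl.comp hns.tendsto_atTop)]

lemma IsGoodUniversal.ae_tendsto_doublingAverage {p : ℝ≥0∞} (hp : 1 ≤ p) {κ : ℕ → ℕ}
    (hgood : IsGoodUniversal p κ) (hκ : IsUniformlyDistributedInt κ) {g : UnitAddCircle → ℂ}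
    (hg : MemLp g p volume) :
    ∀ᵐ x, Tendsto (fun N => doublingAverage κ g N x) atTop (𝓝 (∫ y, g y)) := by
  refine ae_tendsto_doublingAverage_of_exists hκ (hg.integrable hp) ?_
  have h := hgood UnitAddCircle volume (fun x => (2 : ℕ) • x)
    (by simpa using measurePreserving_two_pow_nsmul 1) g hg
  simpa only [smul_iterate_apply, doublingAverage] using h

lemma volume_Ioc_inter_mul_preimage {q : ℝ} (hq : 0 < q) (c : ℝ) {E : Set UnitAddCircle}
    (hE : MeasurableSet E) :
    volume (Set.Ioc c (c + q⁻¹) ∩ {x : ℝ | ((q * x : ℝ) : UnitAddCircle) ∈ E}) =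
      ENNReal.ofReal q⁻¹ * volume E := by
  have h1 : Set.Ioc c (c + q⁻¹) ∩ {x : ℝ | ((q * x : ℝ) : UnitAddCircle) ∈ E} =
      (q * ·) ⁻¹' ((QuotientAddGroup.mk ⁻¹' E : Set ℝ) ∩ Set.Ioc (q * c) (q * c + 1)) := by
    ext x
    have e1 : q * c < q * x ↔ c < x := mul_lt_mul_iff_right₀ hq
    have e2 : q * x ≤ q * c + 1 ↔ x ≤ c + q⁻¹ := by
      rw [← mul_le_mul_iff_right₀ hq (b := x), mul_add, mul_inv_cancel₀ hq.ne']
    simp only [Set.mem_inter_iff, Set.mem_Ioc, Set.mem_preimage, Set.mem_ofPred_eq, e1, e2]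
    exact and_comm
  rw [h1, Real.volume_preimage_mul_left hq.ne', abs_of_pos (inv_pos.2 hq),
    ← AddCircle.add_projection_respects_measure 1 (q * c) hE]

/-- Correlation of an arc around `0` with a set pulled back by `x ↦ 2 ^ d • x`. -/
lemma volume_real_closedBall_inter_le {r : ℝ} (hr : 0 ≤ r) (d : ℕ) {E : Set UnitAddCircle}
    (hE : MeasurableSet E) :
    volume.real (Metric.closedBall (0 : UnitAddCircle) r ∩
      (fun x : UnitAddCircle => (2 ^ d : ℕ) • x) ⁻¹' E) ≤
      (2 * r + 2 * (1 / 2) ^ d) * volume.real E := by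
  set q : ℝ := 2 ^ d with hq
  have hq0 : 0 < q := by positivity
  set M : ℕ := ⌊2 * r * q⌋₊ + 2 with hM
  have hmeas : MeasurableSet (Metric.closedBall (0 : UnitAddCircle) r ∩
      (fun x : UnitAddCircle => (2 ^ d : ℕ) • x) ⁻¹' E) :=
    Metric.isClosed_closedBall.measurableSet.inter
      ((measurePreserving_two_pow_nsmul d).measurable hE)
  have hsub : (QuotientAddGroup.mk ⁻¹' (Metric.closedBall (0 : UnitAddCircle) r ∩
      (fun x : UnitAddCircle => (2 ^ d : ℕ) • x) ⁻¹' E) : Set ℝ) ∩ Set.Ioc (-1 / 2) (-1 / 2 + 1) ⊆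
      ⋃ i ∈ Finset.range M, (Set.Ioc (-r + (i - 1) * q⁻¹) (-r + (i - 1) * q⁻¹ + q⁻¹) ∩
        {x : ℝ | ((q * x : ℝ) : UnitAddCircle) ∈ E}) := by
    rintro x ⟨⟨hx1, hx2⟩, hx3, hx4⟩
    have hxE : ((q * x : ℝ) : UnitAddCircle) ∈ E := by
      have : (2 ^ d : ℕ) • (x : UnitAddCircle) ∈ E := hx2
      rw [← AddCircle.coe_nsmul, nsmul_eq_mul] at this
      simpa [hq] using this
    have hxr : |x| ≤ r := by
      have h1 : ‖(x : UnitAddCircle)‖ ≤ r := by simpa using hx1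
      rwa [(AddCircle.norm_coe_eq_abs_iff (p := 1) one_ne_zero).2
        (by rw [abs_one, abs_le]; constructor <;> linarith)] at h1
    have hxr' := abs_le.1 hxr
    have hnn : 0 ≤ (x + r) * q := mul_nonneg (by linarith) hq0.le
    set i : ℕ := ⌈(x + r) * q⌉₊ with hi
    have hi1 : (i : ℝ) < (x + r) * q + 1 := Nat.ceil_lt_add_one hnn
    have hi2 : (x + r) * q ≤ i := Nat.le_ceil _
    simp only [Set.mem_iUnion, Finset.mem_range, exists_prop]
    refine ⟨i, ?_, ⟨?_, ?_⟩, hxE⟩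
    · have h2 : (i : ℝ) < M := by
        have h3 : (x + r) * q ≤ 2 * r * q := by gcongr; linarith
        have h4 := Nat.lt_floor_add_one (2 * r * q)
        rw [hM]; push_cast; linarith
      exact_mod_cast h2
    · have : ((i : ℝ) - 1) * q⁻¹ < x + r := by
        rw [← div_eq_mul_inv, div_lt_iff₀ hq0]; linarith
      linarith
    · have : x + r ≤ (i : ℝ) * q⁻¹ := by
        rw [← div_eq_mul_inv, le_div_iff₀ hq0]; linarith
      linarith
  have hle : volume (Metric.closedBall (0 : UnitAddCircle) r ∩
      (fun x : UnitAddCircle => (2 ^ d : ℕ) • x) ⁻¹' E) ≤ M * (ENNReal.ofReal q⁻¹ * volume E) := by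
    rw [AddCircle.add_projection_respects_measure 1 (-1 / 2) hmeas]
    refine (measure_mono hsub).trans ((measure_biUnion_finset_le _ _).trans (le_of_eq ?_))
    simp_rw [volume_Ioc_inter_mul_preimage hq0 _ hE]
    simp
  have hle' : volume.real (Metric.closedBall (0 : UnitAddCircle) r ∩
      (fun x : UnitAddCircle => (2 ^ d : ℕ) • x) ⁻¹' E) ≤ M * (q⁻¹ * volume.real E) := by
    have h := ENNReal.toReal_mono (by finiteness) hle
    rwa [ENNReal.toReal_mul, ENNReal.toReal_mul, ENNReal.toReal_natCast,
      ENNReal.toReal_ofReal (inv_nonneg.2 hq0.le)] at h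
  refine hle'.trans ?_
  rw [← mul_assoc]
  gcongr
  rw [← div_eq_mul_inv, div_le_iff₀ hq0, hM]
  have h1 := Nat.floor_le (by positivity : 0 ≤ 2 * r * q)
  have h2 : (1 / 2 : ℝ) ^ d * q = 1 := by rw [hq, ← mul_pow]; norm_num
  push_cast
  linear_combination h1 - 2 * h2

lemma sum_half_pow_dist_le {κ : ℕ → ℕ} (hκ : Function.Injective κ) (v N : ℕ) :
    ∑ n ∈ Finset.range N, (1 / 2 : ℝ) ^ (Nat.dist v (κ n)) ≤ 4 := by
  have key : ∀ (s : Finset ℕ) (f : ℕ → ℕ), Set.InjOn f s → ∑ n ∈ s, (1 / 2 : ℝ) ^ f n ≤ 2 := by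
    intro s f hf
    rw [← Finset.sum_image (f := fun k => (1 / 2 : ℝ) ^ k) hf]
    exact (summable_geometric_two.sum_le_tsum _ fun _ _ => by positivity).trans
      tsum_geometric_two.le
  rw [← Finset.sum_filter_add_sum_filter_not _ (fun n => κ n ≤ v)]
  have h1 := key ((Finset.range N).filter fun n => κ n ≤ v) (fun n => Nat.dist v (κ n)) (by
    intro a ha b hb hab
    simp only [Finset.coe_filter, Set.mem_ofPred_eq] at ha hb
    simp only [Nat.dist_eq_sub_of_le_right ha.2, Nat.dist_eq_sub_of_le_right hb.2] at hab
    exact hκ (by omega))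
  have h2 := key ((Finset.range N).filter fun n => ¬κ n ≤ v) (fun n => Nat.dist v (κ n)) (by
    intro a ha b hb hab
    simp only [Finset.coe_filter, Set.mem_ofPred_eq, not_le] at ha hb
    simp only [Nat.dist_eq_sub_of_le ha.2.le, Nat.dist_eq_sub_of_le hb.2.le] at hab
    exact hκ (by omega))
  linarith

lemma integral_mul_comp_two_pow {φ : UnitAddCircle → ℝ} (hφ : Measurable φ) (a b : ℕ) :
    ∫ x : UnitAddCircle, φ ((2 ^ a : ℕ) • x) * φ ((2 ^ b : ℕ) • x) =
      ∫ x, φ x * φ ((2 ^ Nat.dist a b : ℕ) • x) := by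
  wlog hab : a ≤ b generalizing a b
  · rw [Nat.dist_comm, ← this b a (by omega)]
    simp_rw [mul_comm]
  have hm : Measurable fun x : UnitAddCircle => φ x * φ ((2 ^ Nat.dist a b : ℕ) • x) :=
    hφ.mul (hφ.comp (measurePreserving_two_pow_nsmul _).measurable)
  rw [← integral_comp_two_pow hm.aestronglyMeasurable a]
  congr 1
  funext x
  rw [← mul_nsmul', ← pow_add, Nat.dist_eq_sub_of_le hab, Nat.sub_add_cancel hab]

/-- Weak-type estimate for sums along an injective sequence from decay of correlations. -/
lemma measure_sum_ge_le {κ : ℕ → ℕ} (hκ : Function.Injective κ) {φ : UnitAddCircle → ℝ}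
    (hφ : Measurable φ) {S D t : ℝ} (hφ0 : ∀ x, |φ x| ≤ S) (hD : 0 ≤ D) (ht : 0 < t)
    (hcorr : ∀ d : ℕ, ∫ x, φ x * φ ((2 ^ d : ℕ) • x) ≤ (∫ x, φ x) ^ 2 + (1 / 2) ^ d * D)
    {N : ℕ} (hN : 0 < N) :
    volume {x : UnitAddCircle | N * ((∫ x, φ x) + t) ≤
      ∑ n ∈ Finset.range N, φ ((2 ^ κ n : ℕ) • x)} ≤ ENNReal.ofReal (4 * D / (N * t ^ 2)) := by
  have hN0 : (0 : ℝ) < N := by exact_mod_cast hN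
  set m : ℝ := ∫ x, φ x with hm
  have hms : ∀ d : ℕ, Measurable fun x : UnitAddCircle => φ ((2 ^ d : ℕ) • x) := fun d =>
    hφ.comp (measurePreserving_two_pow_nsmul d).measurable
  have hint : ∀ d : ℕ, Integrable fun x : UnitAddCircle => φ ((2 ^ d : ℕ) • x) := fun d =>
    Integrable.of_bound (hms d).aestronglyMeasurable S (Eventually.of_forall fun x => hφ0 _)
  have hint2 : ∀ a b : ℕ, Integrable fun x : UnitAddCircle =>
      φ ((2 ^ a : ℕ) • x) * φ ((2 ^ b : ℕ) • x) := fun a b =>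
    Integrable.of_bound ((hms a).mul (hms b)).aestronglyMeasurable (S * S)
      (Eventually.of_forall fun x => by
        rw [norm_mul]
        have := (abs_nonneg _).trans (hφ0 x)
        exact mul_le_mul (hφ0 _) (hφ0 _) (norm_nonneg _) this)
  let X : UnitAddCircle → ℝ := fun x => ∑ n ∈ Finset.range N, φ ((2 ^ κ n : ℕ) • x)
  have hX : MemLp X 2 volume := memLp_finsetSum _ fun n _ =>
    MemLp.of_bound (hms _).aestronglyMeasurable S (Eventually.of_forall fun x => hφ0 _)
  have hEX : ∫ x, X x = N * m := by
    simp only [X]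
    rw [integral_finsetSum _ fun n _ => hint _]
    simp_rw [integral_comp_two_pow hφ.aestronglyMeasurable]
    simp [hm]
  have hEX2 : ∫ x, X x ^ 2 ≤ (N * m) ^ 2 + N * (4 * D) := by
    have e : ∀ x, X x ^ 2 = ∑ a ∈ Finset.range N, ∑ b ∈ Finset.range N,
        φ ((2 ^ κ a : ℕ) • x) * φ ((2 ^ κ b : ℕ) • x) := fun x => by
      simp only [X]; rw [sq, Finset.sum_mul_sum]
    simp_rw [e]
    rw [integral_finsetSum _ fun a _ => integrable_finsetSum _ fun b _ => hint2 _ _]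
    have hrow : ∀ a ∈ Finset.range N, ∫ x : UnitAddCircle, ∑ b ∈ Finset.range N,
        φ ((2 ^ κ a : ℕ) • x) * φ ((2 ^ κ b : ℕ) • x) ≤ N * m ^ 2 + 4 * D := by
      intro a _
      rw [integral_finsetSum _ fun b _ => hint2 _ _]
      simp_rw [integral_mul_comp_two_pow hφ]
      refine (Finset.sum_le_sum fun b _ => hcorr _).trans ?_
      rw [Finset.sum_add_distrib, ← Finset.sum_mul]
      have := sum_half_pow_dist_le hκ (κ a) N
      have h2 : (∑ n ∈ Finset.range N, (1 / 2 : ℝ) ^ (Nat.dist (κ a) (κ n))) * D ≤ 4 * D := by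
        gcongr
      simpa using h2
    refine (Finset.sum_le_card_nsmul _ _ _ hrow).trans (le_of_eq ?_)
    rw [Finset.card_range, nsmul_eq_mul]
    ring
  have hvar : variance X volume ≤ N * (4 * D) := by
    rw [variance_eq_sub hX, hEX]
    have : ∫ x, (X ^ 2) x = ∫ x, X x ^ 2 := rfl
    rw [this]
    linarith
  have hc := meas_ge_le_variance_div_sq hX (mul_pos hN0 ht)
  refine (measure_mono fun x hx => ?_).trans (hc.trans (ENNReal.ofReal_le_ofReal ?_))
  · have hx' : N * (m + t) ≤ X x := hx
    have : N * t ≤ X x - ∫ x, X x := by rw [hEX]; linarith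
    exact this.trans (le_abs_self _)
  · calc variance X volume / (N * t) ^ 2 ≤ N * (4 * D) / (N * t) ^ 2 := by gcongr
      _ = 4 * D / (N * t ^ 2) := by field_simp

/-- The arc of length `2⁻ʲ` around `0`. -/
def dyadicArc (j : ℕ) : Set UnitAddCircle := Metric.closedBall 0 ((1 / 2) ^ (j + 1))

lemma measurableSet_dyadicArc (j : ℕ) : MeasurableSet (dyadicArc j) :=
  Metric.isClosed_closedBall.measurableSet

lemma dyadicArc_antitone : Antitone dyadicArc := fun i j hij =>
  Metric.closedBall_subset_closedBall
    (pow_le_pow_of_le_one (by norm_num) (by norm_num) (by omega))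

lemma volume_real_dyadicArc (j : ℕ) : volume.real (dyadicArc j) = (1 / 2) ^ j := by
  have h : (1 / 2 : ℝ) ^ j ≤ 1 := pow_le_one₀ (by norm_num) (by norm_num)
  rw [dyadicArc, Measure.real, AddCircle.volume_closedBall, show (2 : ℝ) * (1 / 2) ^ (j + 1) =
    (1 / 2) ^ j by rw [pow_succ]; ring, min_eq_right h, ENNReal.toReal_ofReal (by positivity)]

/-- Step function dominating, away from `dyadicArc K`, a singularity at `0` cut off outside
`dyadicArc J`. -/
noncomputable def singularStep (ρ : ℝ) (J K : ℕ) (x : UnitAddCircle) : ℝ :=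
  ∑ j ∈ Finset.Ico J K, ρ ^ j * (dyadicArc j).indicator 1 x

section singularStep

variable {ρ : ℝ}

lemma singularStep_nonneg (hρ : 0 ≤ ρ) (J K : ℕ) (x : UnitAddCircle) : 0 ≤ singularStep ρ J K x :=
  Finset.sum_nonneg fun j _ => mul_nonneg (by positivity)
    (Set.indicator_nonneg (fun _ _ => zero_le_one) _)

lemma measurable_singularStep (J K : ℕ) : Measurable (singularStep ρ J K) :=
  Finset.measurable_fun_sum _ fun j _ =>
    (measurable_one.indicator (measurableSet_dyadicArc j)).const_mul _

lemma singularStep_le (hρ : 0 ≤ ρ) (J K : ℕ) (x : UnitAddCircle) :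
    singularStep ρ J K x ≤ ∑ j ∈ Finset.Ico J K, ρ ^ j :=
  Finset.sum_le_sum fun j _ => mul_le_of_le_one_right (by positivity)
    (Set.indicator_le_self' (fun _ _ => zero_le_one) x |>.trans (by simp))

lemma integral_singularStep (J K : ℕ) :
    ∫ x, singularStep ρ J K x = ∑ j ∈ Finset.Ico J K, ρ ^ j * (1 / 2) ^ j := by
  have hint : ∀ j, Integrable fun x => ρ ^ j *
      (dyadicArc j).indicator (1 : UnitAddCircle → ℝ) x := fun j =>
    ((integrable_const (1 : ℝ)).indicator (measurableSet_dyadicArc j)).const_mul _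
  simp only [singularStep]
  rw [integral_finsetSum _ fun j _ => hint j]
  refine Finset.sum_congr rfl fun j _ => ?_
  rw [integral_const_mul, integral_indicator_one (measurableSet_dyadicArc j), volume_real_dyadicArc]

lemma integral_singularStep_mul_comp_le (hρ : 0 ≤ ρ) (J K d : ℕ) :
    ∫ x, singularStep ρ J K x * singularStep ρ J K ((2 ^ d : ℕ) • x) ≤
      (∫ x, singularStep ρ J K x) ^ 2 + (1 / 2) ^ d *
        (2 * (∑ j ∈ Finset.Ico J K, ρ ^ j) * ∫ x, singularStep ρ J K x) := by
  have hD := (measurePreserving_two_pow_nsmul d).measurable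
  have e : ∀ x, singularStep ρ J K x * singularStep ρ J K ((2 ^ d : ℕ) • x) =
      ∑ i ∈ Finset.Ico J K, ∑ j ∈ Finset.Ico J K, ρ ^ i * ρ ^ j *
        (dyadicArc i ∩ (fun x : UnitAddCircle => (2 ^ d : ℕ) • x) ⁻¹' dyadicArc j).indicator 1 x := by
    intro x
    rw [singularStep, singularStep, Finset.sum_mul_sum]
    refine Finset.sum_congr rfl fun i _ => Finset.sum_congr rfl fun j _ => ?_
    rw [Set.inter_indicator_one, Pi.mul_apply]
    have : (dyadicArc j).indicator (1 : UnitAddCircle → ℝ) ((2 ^ d : ℕ) • x) =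
      ((fun x : UnitAddCircle => (2 ^ d : ℕ) • x) ⁻¹' dyadicArc j).indicator 1 x := rfl
    rw [this]
    ring
  have hm : ∀ i j, MeasurableSet
      (dyadicArc i ∩ (fun x : UnitAddCircle => (2 ^ d : ℕ) • x) ⁻¹' dyadicArc j) := fun i j =>
    (measurableSet_dyadicArc i).inter (hD (measurableSet_dyadicArc j))
  have hint : ∀ i j, Integrable fun x => ρ ^ i * ρ ^ j *
      (dyadicArc i ∩ (fun x : UnitAddCircle => (2 ^ d : ℕ) • x) ⁻¹' dyadicArc j).indicator
        (1 : UnitAddCircle → ℝ) x := fun i j =>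
    ((integrable_const (1 : ℝ)).indicator (hm i j)).const_mul _
  simp_rw [e]
  rw [integral_finsetSum _ fun i _ => integrable_finsetSum _ fun j _ => hint i j]
  have hI : ∀ i, ∫ x, ∑ j ∈ Finset.Ico J K, ρ ^ i * ρ ^ j *
      (dyadicArc i ∩ (fun x : UnitAddCircle => (2 ^ d : ℕ) • x) ⁻¹' dyadicArc j).indicator
        (1 : UnitAddCircle → ℝ) x = ∑ j ∈ Finset.Ico J K, ρ ^ i * ρ ^ j *
      volume.real (dyadicArc i ∩ (fun x : UnitAddCircle => (2 ^ d : ℕ) • x) ⁻¹' dyadicArc j) := by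
    intro i
    rw [integral_finsetSum _ fun j _ => hint i j]
    refine Finset.sum_congr rfl fun j _ => ?_
    rw [integral_const_mul, integral_indicator_one (hm i j)]
  simp_rw [hI]
  have hb : ∀ i j, volume.real
      (dyadicArc i ∩ (fun x : UnitAddCircle => (2 ^ d : ℕ) • x) ⁻¹' dyadicArc j) ≤
      ((1 / 2) ^ i + 2 * (1 / 2) ^ d) * (1 / 2) ^ j := fun i j => by
    have h := volume_real_closedBall_inter_le (r := (1 / 2) ^ (i + 1)) (by positivity) d
      (measurableSet_dyadicArc j)
    rw [volume_real_dyadicArc, show (2 : ℝ) * (1 / 2) ^ (i + 1) = (1 / 2) ^ i by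
      rw [pow_succ]; ring] at h
    exact h
  calc _ ≤ ∑ i ∈ Finset.Ico J K, ∑ j ∈ Finset.Ico J K, ρ ^ i * ρ ^ j *
        (((1 / 2) ^ i + 2 * (1 / 2) ^ d) * (1 / 2) ^ j) := by
        gcongr with i _ j _
        exact hb i j
    _ = (∑ i ∈ Finset.Ico J K, (ρ ^ i * (1 / 2) ^ i + 2 * (1 / 2) ^ d * ρ ^ i)) *
        ∑ j ∈ Finset.Ico J K, ρ ^ j * (1 / 2) ^ j := by
        rw [Finset.sum_mul_sum]
        refine Finset.sum_congr rfl fun i _ => Finset.sum_congr rfl fun j _ => ?_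
        ring
    _ = _ := by
        rw [Finset.sum_add_distrib, ← Finset.mul_sum, integral_singularStep]
        ring

lemma sum_Ico_half_mul_pow_le (hρ : 0 < ρ) (hρ2 : ρ < 2) (J K : ℕ) :
    ∑ j ∈ Finset.Ico J K, ρ ^ j * (1 / 2) ^ j ≤ (ρ / 2) ^ J / (1 - ρ / 2) := by
  simp_rw [← mul_pow, mul_one_div]
  exact geom_sum_Ico_le_of_lt_one (by linarith) (by linarith)

lemma sum_Ico_pow_le (hρ : 1 < ρ) (J K : ℕ) :
    ∑ j ∈ Finset.Ico J K, ρ ^ j ≤ ρ ^ K / (ρ - 1) := by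
  have h1 : 0 < ρ - 1 := by linarith
  calc ∑ j ∈ Finset.Ico J K, ρ ^ j ≤ ∑ j ∈ Finset.range K, ρ ^ j :=
        Finset.sum_le_sum_of_subset_of_nonneg
          (fun j hj => by simp at hj ⊢; exact hj.2) fun j _ _ => by positivity
    _ = (ρ ^ K - 1) / (ρ - 1) := geom_sum_eq hρ.ne' K
    _ ≤ _ := by gcongr; linarith

lemma indicator_le_mul_singularStep (hρ : 0 ≤ ρ) {w : UnitAddCircle → ℝ} {C : ℝ} (hC : 0 ≤ C)
    (hw : ∀ j, ∀ x ∉ dyadicArc (j + 1), w x ≤ C * ρ ^ j) (J K : ℕ) {x : UnitAddCircle}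
    (hx : x ∉ dyadicArc K) :
    (dyadicArc J).indicator w x ≤ C * singularStep ρ J K x := by
  classical
  by_cases hxJ : x ∈ dyadicArc J
  · have hex : ∃ j, x ∉ dyadicArc (J + j + 1) := ⟨K, fun h => hx (dyadicArc_antitone (by omega) h)⟩
    set j := J + Nat.find hex with hj
    have h1 : x ∉ dyadicArc (j + 1) := Nat.find_spec hex
    have h2 : x ∈ dyadicArc j := by
      rcases Nat.eq_zero_or_pos (Nat.find hex) with h0 | h0
      · rw [hj, h0]; exact hxJ
      · have := Nat.find_min hex (Nat.sub_lt h0 one_pos)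
        rw [not_not] at this
        rw [hj]
        convert this using 2
        omega
    have hjK : j < K := by
      by_contra! hle
      exact hx (dyadicArc_antitone hle h2)
    rw [Set.indicator_of_mem hxJ]
    refine (hw j x h1).trans ?_
    gcongr
    have h3 := Finset.single_le_sum (s := Finset.Ico J K)
      (f := fun j => ρ ^ j * (dyadicArc j).indicator (1 : UnitAddCircle → ℝ) x)
      (fun j _ => mul_nonneg (by positivity) (Set.indicator_nonneg (fun _ _ => zero_le_one) _))
      (Finset.mem_Ico.2 ⟨by omega, hjK⟩)
    simpa [singularStep, h2] using h3
  · rw [Set.indicator_of_notMem hxJ]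
    exact mul_nonneg hC (singularStep_nonneg hρ J K x)

end singularStep

lemma ae_eventually_not_mem_dyadicArc (κ : ℕ → ℕ) (q : ℕ) :
    ∀ᵐ x : UnitAddCircle, ∀ᶠ i : ℕ in atTop, ∀ n < 2 ^ (q * i),
      (2 ^ κ n : ℕ) • x ∉ dyadicArc ((q + 1) * i) := by
  have hb : ∀ i : ℕ, volume (⋃ n ∈ Finset.range (2 ^ (q * i)),
      (fun x : UnitAddCircle => (2 ^ κ n : ℕ) • x) ⁻¹' dyadicArc ((q + 1) * i)) ≤
      ENNReal.ofReal ((1 / 2) ^ i) := by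
    intro i
    refine (measure_biUnion_finset_le _ _).trans ?_
    have h1 : ∀ n, volume ((fun x : UnitAddCircle => (2 ^ κ n : ℕ) • x) ⁻¹'
        dyadicArc ((q + 1) * i)) = ENNReal.ofReal ((1 / 2) ^ ((q + 1) * i)) := fun n => by
      rw [(measurePreserving_two_pow_nsmul (κ n)).measure_preimage
        (measurableSet_dyadicArc _).nullMeasurableSet, ← volume_real_dyadicArc,
        ofReal_measureReal]
    simp_rw [h1]
    rw [Finset.sum_const, Finset.card_range, nsmul_eq_mul, ← ENNReal.ofReal_natCast,
      ← ENNReal.ofReal_mul (by positivity)]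
    refine ENNReal.ofReal_le_ofReal (le_of_eq ?_)
    push_cast
    rw [add_mul, one_mul, pow_add, ← mul_assoc, ← mul_pow]
    norm_num
  have hsum : ∑' i : ℕ, volume (⋃ n ∈ Finset.range (2 ^ (q * i)),
      (fun x : UnitAddCircle => (2 ^ κ n : ℕ) • x) ⁻¹' dyadicArc ((q + 1) * i)) ≠ ∞ :=
    ne_top_of_le_ne_top summable_geometric_two.tsum_ofReal_ne_top (ENNReal.tsum_le_tsum hb)
  filter_upwards [ae_eventually_notMem hsum] with x hx
  filter_upwards [hx] with i hi n hn hmem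
  exact hi (Set.mem_biUnion (Finset.mem_coe.2 (Finset.mem_range.2 hn)) hmem)

lemma ae_eventually_sum_singularStep_le {κ : ℕ → ℕ} (hκ : Function.Injective κ) {ρ : ℝ}
    (hρ : 1 < ρ) (hρ2 : ρ < 2) {q : ℕ} (hq : (ρ / 2) ^ q * ρ < 1) (J : ℕ) :
    ∀ᵐ x : UnitAddCircle, ∀ᶠ i : ℕ in atTop,
      ∑ n ∈ Finset.range (2 ^ (q * i)), singularStep ρ J ((q + 1) * i) ((2 ^ κ n : ℕ) • x) ≤
        2 ^ (q * i) * (2 * ((ρ / 2) ^ J / (1 - ρ / 2))) := by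
  have hρ0 : 0 < ρ := by linarith
  set M : ℝ := (ρ / 2) ^ J / (1 - ρ / 2) with hM
  have h1 : 0 < 1 - ρ / 2 := by linarith
  have h2 : 0 < ρ - 1 := by linarith
  have hM0 : 0 < M := by positivity
  have hb : ∀ i : ℕ, volume {x : UnitAddCircle | 2 ^ (q * i) * (2 * M) <
      ∑ n ∈ Finset.range (2 ^ (q * i)), singularStep ρ J ((q + 1) * i) ((2 ^ κ n : ℕ) • x)} ≤
      ENNReal.ofReal (8 / ((ρ - 1) * M) * ((ρ / 2) ^ q * ρ) ^ i) := by
    intro i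
    set K := (q + 1) * i with hK
    set m := ∫ x, singularStep ρ J K x with hm
    set S := ∑ j ∈ Finset.Ico J K, ρ ^ j with hS
    have hmM : m ≤ M := by
      rw [hm, integral_singularStep]; exact sum_Ico_half_mul_pow_le hρ0 hρ2 J K
    have hm0 : 0 ≤ m := integral_nonneg fun x => singularStep_nonneg hρ0.le J K x
    have hS0 : 0 ≤ S := Finset.sum_nonneg fun _ _ => by positivity
    have hSle : S ≤ ρ ^ K / (ρ - 1) := sum_Ico_pow_le hρ J K
    have h := measure_sum_ge_le hκ (measurable_singularStep (ρ := ρ) J K) (S := S)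
      (D := 2 * S * m) (t := M)
      (fun x => by
        rw [abs_of_nonneg (singularStep_nonneg hρ0.le J K x)]
        exact singularStep_le hρ0.le J K x)
      (by positivity) hM0 (integral_singularStep_mul_comp_le hρ0.le J K)
      (N := 2 ^ (q * i)) (by positivity)
    refine (measure_mono fun x hx => ?_).trans (h.trans (ENNReal.ofReal_le_ofReal ?_))
    · have hx' : (2 : ℝ) ^ (q * i) * (2 * M) <
        ∑ n ∈ Finset.range (2 ^ (q * i)), singularStep ρ J K ((2 ^ κ n : ℕ) • x) := hx
      refine le_trans ?_ hx'.le
      push_cast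
      gcongr
      linarith
    · push_cast
      have e : ((ρ / 2) ^ q * ρ) ^ i = ρ ^ K / 2 ^ (q * i) := by
        rw [hK, mul_pow, ← pow_mul, div_pow, add_mul, one_mul, pow_add]
        ring
      rw [e]
      calc 4 * (2 * S * m) / (2 ^ (q * i) * M ^ 2)
          ≤ 4 * (2 * (ρ ^ K / (ρ - 1)) * M) / (2 ^ (q * i) * M ^ 2) := by gcongr
        _ = _ := by field_simp; ring
  have hsum : ∑' i : ℕ, volume {x : UnitAddCircle | 2 ^ (q * i) * (2 * M) <
      ∑ n ∈ Finset.range (2 ^ (q * i)), singularStep ρ J ((q + 1) * i) ((2 ^ κ n : ℕ) • x)} ≠ ∞ :=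
    ne_top_of_le_ne_top
      ((summable_geometric_of_lt_one (by positivity) hq).mul_left _).tsum_ofReal_ne_top
      (ENNReal.tsum_le_tsum hb)
  filter_upwards [ae_eventually_notMem hsum] with x hx
  filter_upwards [hx] with i hi
  exact not_lt.1 hi

/-- Along an injective sequence, the averages of the singular part of a function with an integrable
power singularity at `0` are eventually small, almost everywhere. -/
lemma exists_ae_eventually_average_indicator_le {κ : ℕ → ℕ} (hκ : Function.Injective κ) {ρ : ℝ}
    (hρ : 1 < ρ) (hρ2 : ρ < 2) :
    ∃ A, ∀ᵐ x : UnitAddCircle, ∀ (w : UnitAddCircle → ℝ) (C : ℝ), 0 ≤ C →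
      (∀ j, ∀ x ∉ dyadicArc (j + 1), w x ≤ C * ρ ^ j) → ∀ J : ℕ, ∀ᶠ N : ℕ in atTop,
        (N : ℝ)⁻¹ * ∑ n ∈ Finset.range N, (dyadicArc J).indicator w ((2 ^ κ n : ℕ) • x) ≤
          A * C * (ρ / 2) ^ J := by
  have hρ0 : 0 < ρ := by linarith
  obtain ⟨q, hq⟩ : ∃ q : ℕ, (ρ / 2) ^ q * ρ < 1 := by
    obtain ⟨q, hq⟩ := exists_pow_lt_of_lt_one (inv_pos.2 hρ0) (by linarith : ρ / 2 < 1)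
    exact ⟨q, by rwa [← lt_div_iff₀ hρ0, one_div]⟩
  have hq0 : q ≠ 0 := by
    rintro rfl
    rw [pow_zero, one_mul] at hq
    linarith
  have h1 : 0 < 1 - ρ / 2 := by linarith
  refine ⟨2 ^ q * 2 / (1 - ρ / 2), ?_⟩
  filter_upwards [ae_eventually_not_mem_dyadicArc κ q, ae_all_iff.2 fun J =>
    ae_eventually_sum_singularStep_le hκ hρ hρ2 hq J] with x hx1 hx2 w C hC hw J
  obtain ⟨i₀, hi₀⟩ := eventually_atTop.1 (hx1.and (hx2 J))
  filter_upwards [eventually_ge_atTop (2 ^ (q * i₀))] with N hN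
  have hNpos : 0 < N := lt_of_lt_of_le (by positivity) hN
  have hN0 : (0 : ℝ) < N := by exact_mod_cast hNpos
  have hb : 1 < 2 ^ q := Nat.one_lt_two_pow hq0
  set i := Nat.log (2 ^ q) N with hi
  have hle : 2 ^ (q * i) ≤ N := by rw [pow_mul]; exact Nat.pow_log_le_self _ hNpos.ne'
  have hlt : N < 2 ^ (q * (i + 1)) := by rw [pow_mul]; exact Nat.lt_pow_succ_log_self hb N
  have hii : i₀ ≤ i + 1 := by
    have : 2 ^ (q * i₀) < 2 ^ (q * (i + 1)) := lt_of_le_of_lt hN hlt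
    have := (Nat.pow_lt_pow_iff_right (by norm_num)).1 this
    exact (Nat.lt_of_mul_lt_mul_left this).le
  obtain ⟨ha, hs⟩ := hi₀ (i + 1) hii
  rw [inv_mul_le_iff₀ hN0]
  calc ∑ n ∈ Finset.range N, (dyadicArc J).indicator w ((2 ^ κ n : ℕ) • x)
      ≤ ∑ n ∈ Finset.range N, C * singularStep ρ J ((q + 1) * (i + 1)) ((2 ^ κ n : ℕ) • x) :=
        Finset.sum_le_sum fun n hn => indicator_le_mul_singularStep hρ0.le hC hw J _
          (ha n ((Finset.mem_range.1 hn).trans hlt))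
    _ ≤ C * ∑ n ∈ Finset.range (2 ^ (q * (i + 1))),
          singularStep ρ J ((q + 1) * (i + 1)) ((2 ^ κ n : ℕ) • x) := by
        rw [← Finset.mul_sum]
        gcongr
        · exact fun n _ _ => singularStep_nonneg hρ0.le _ _ _
    _ ≤ C * (2 ^ (q * (i + 1)) * (2 * ((ρ / 2) ^ J / (1 - ρ / 2)))) := by gcongr
    _ ≤ C * (N * 2 ^ q * (2 * ((ρ / 2) ^ J / (1 - ρ / 2)))) := by
        gcongr
        rw [mul_add, mul_one, pow_add]
        gcongr
        exact_mod_cast hle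
    _ = _ := by ring

/-- Along an injective sequence, the averages of a function with an integrable power singularity
at `0` converge almost everywhere. -/
lemma IsGoodUniversal.ae_tendsto_doublingAverage_of_injective {p : ℝ≥0∞} (hp : 1 ≤ p) {κ : ℕ → ℕ}
    (hgood : IsGoodUniversal p κ) (hκ : IsUniformlyDistributedInt κ)
    (hinj : Function.Injective κ) {G : UnitAddCircle → ℂ} (hG : Integrable G) {ρ C : ℝ}
    (hρ : 1 < ρ) (hρ2 : ρ < 2) (hC : 0 ≤ C)
    (hGC : ∀ j, ∀ x ∉ dyadicArc (j + 1), ‖G x‖ ≤ C * ρ ^ j) :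
    ∀ᵐ x, Tendsto (fun N => doublingAverage κ G N x) atTop (𝓝 (∫ y, G y)) := by
  have hB : ∀ J, MemLp ((dyadicArc (J + 1))ᶜ.indicator G) p volume := fun J => by
    refine MemLp.of_bound (hG.1.indicator (measurableSet_dyadicArc _).compl) (C * ρ ^ J)
      (ae_of_all _ fun x => ?_)
    by_cases hx : x ∈ dyadicArc (J + 1)
    · rw [Set.indicator_of_notMem (by simpa using hx), norm_zero]
      positivity
    · rw [Set.indicator_of_mem (by simpa using hx)]
      exact hGC J x hx
  obtain ⟨A, hA⟩ := exists_ae_eventually_average_indicator_le hinj hρ hρ2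
  have hT : Tendsto (fun J : ℕ => ∫ x in dyadicArc (J + 1), G x) atTop (𝓝 0) := by
    refine hG.tendsto_setIntegral_nhds_zero ?_
    have h1 : Tendsto (fun J : ℕ => ENNReal.ofReal ((1 / 2) ^ (J + 1))) atTop (𝓝 0) := by
      rw [← ENNReal.ofReal_zero]
      exact (ENNReal.continuous_ofReal.tendsto 0).comp
        ((tendsto_pow_atTop_nhds_zero_of_lt_one (by norm_num) (by norm_num)).comp
          (tendsto_add_atTop_nat 1))
    refine h1.congr fun J => ?_
    rw [Function.comp_apply, ← volume_real_dyadicArc, ofReal_measureReal]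
  have hR : Tendsto (fun J : ℕ => A * C * (ρ / 2) ^ (J + 1)) atTop (𝓝 0) := by
    simpa using ((tendsto_pow_atTop_nhds_zero_of_lt_one (by positivity)
      (by linarith : ρ / 2 < 1)).comp (tendsto_add_atTop_nat 1)).const_mul (A * C)
  filter_upwards [hA, ae_all_iff.2 fun J => hgood.ae_tendsto_doublingAverage hp hκ (hB J)]
    with x hx hxB
  rw [Metric.tendsto_nhds]
  intro ε hε
  obtain ⟨J, hJT, hJR⟩ := ((Metric.tendsto_nhds.1 hT (ε / 3) (by positivity)).and
    (hR.eventually (gt_mem_nhds (by positivity : 0 < ε / 3)))).exists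
  filter_upwards [hx (fun y => ‖G y‖) C hC hGC (J + 1),
    Metric.tendsto_nhds.1 (hxB J) (ε / 3) (by positivity)] with N h1 h2
  have hsplit : G = (dyadicArc (J + 1))ᶜ.indicator G + (dyadicArc (J + 1)).indicator G := by
    rw [add_comm, Set.indicator_self_add_compl]
  have hint : ∫ y, G y = (∫ y, (dyadicArc (J + 1))ᶜ.indicator G y) +
      ∫ y in dyadicArc (J + 1), G y := by
    rw [integral_indicator (measurableSet_dyadicArc _).compl, add_comm,
      integral_add_compl (measurableSet_dyadicArc _) hG]
  have h3 : ‖doublingAverage κ ((dyadicArc (J + 1)).indicator G) N x‖ < ε / 3 := by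
    refine lt_of_le_of_lt ((norm_doublingAverage_le _ _ _ _).trans ?_) hJR
    simpa only [norm_indicator_eq_indicator_norm] using h1
  rw [dist_eq_norm] at h2 hJT ⊢
  rw [sub_zero] at hJT
  calc ‖doublingAverage κ G N x - ∫ y, G y‖
      = ‖(doublingAverage κ ((dyadicArc (J + 1))ᶜ.indicator G) N x -
            ∫ y, (dyadicArc (J + 1))ᶜ.indicator G y) +
          (doublingAverage κ ((dyadicArc (J + 1)).indicator G) N x -
            ∫ y in dyadicArc (J + 1), G y)‖ := by
        rw [hint, ← add_sub_add_comm, ← doublingAverage_add, ← hsplit]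
    _ ≤ _ + (_ + _) := (norm_add_le _ _).trans (by gcongr; exact norm_sub_le _ _)
    _ < ε / 3 + (ε / 3 + ε / 3) := by gcongr
    _ = ε := by ring

lemma exists_norm_comp_cauchyCot_le {α : ℝ} (hα : 0 < α) (β : ℝ) {f : ℝ → ℂ} {a C : ℝ} (ha : 0 ≤ a)
    (hC : 0 ≤ C) (hf : ∀ τ, ‖f τ‖ ≤ C * (1 + |τ|) ^ a) :
    ∃ D, 0 ≤ D ∧ ∀ j, ∀ x ∉ dyadicArc (j + 1), ‖f (cauchyCot α β x)‖ ≤ D * ((2 : ℝ) ^ a) ^ j := by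
  refine ⟨C * (1 + |β| + 2 * α) ^ a, by positivity, fun j x hx => (hf _).trans ?_⟩
  have hx1 : (1 / 2 : ℝ) ^ (j + 2) < ‖x‖ := by simpa [dyadicArc] using hx
  have hx0 : 0 < ‖x‖ := lt_trans (by positivity) hx1
  have h2 : (1 : ℝ) ≤ 2 ^ j := one_le_pow₀ one_le_two
  have h1 : 1 + |cauchyCot α β x| ≤ (1 + |β| + 2 * α) * 2 ^ j := by
    have h3 : α / (2 * ‖x‖) ≤ 2 * α * 2 ^ j := by
      rw [div_le_iff₀ (by positivity)]
      calc α = 2 * α * 2 ^ j * (2 * (1 / 2) ^ (j + 2)) := by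
            rw [pow_add, one_div, inv_pow]; field_simp
        _ ≤ _ := by gcongr
    have h4 : 1 + |β| ≤ (1 + |β|) * 2 ^ j := le_mul_of_one_le_right (by positivity) h2
    linarith [abs_cauchyCot_le hα β hx0]
  rw [mul_assoc]
  gcongr
  calc (1 + |cauchyCot α β x|) ^ a ≤ ((1 + |β| + 2 * α) * 2 ^ j) ^ a := by gcongr
    _ = _ := by
      rw [Real.mul_rpow (by positivity) (by positivity), ← Real.rpow_natCast_mul zero_le_two,
        mul_comm (j : ℝ), Real.rpow_mul_natCast zero_le_two]

section cauchyMeasure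

variable {α : ℝ}

lemma cauchyMeasure_toNNReal (hα : 0 < α) (β : ℝ) : cauchyMeasure β α.toNNReal =
    volume.withDensity fun τ => ENNReal.ofReal (α / Real.pi * (α ^ 2 + (τ - β) ^ 2)⁻¹) := by
  rw [cauchyMeasure_of_scale_ne_zero _ (by simpa using hα)]
  congr 1
  funext τ
  rw [cauchyPDF_def, cauchyPDFReal_toNNReal hα]

lemma integrable_cauchyMeasure_iff (hα : 0 < α) (β : ℝ) {f : ℝ → ℂ} :
    Integrable f (cauchyMeasure β α.toNNReal) ↔
      Integrable fun τ => f τ / ((α ^ 2 + (τ - β) ^ 2 : ℝ) : ℂ) := by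
  have hc : ((α / Real.pi : ℝ) : ℂ) ≠ 0 := by
    rw [Complex.ofReal_ne_zero]; positivity
  rw [cauchyMeasure_toNNReal hα, integrable_withDensity_iff_integrable_smul' (by fun_prop)
    (ae_of_all _ fun _ => ENNReal.ofReal_lt_top), ← integrable_const_mul_iff hc.isUnit
      fun τ => f τ / ((α ^ 2 + (τ - β) ^ 2 : ℝ) : ℂ)]
  refine integrable_congr (ae_of_all _ fun τ => ?_)
  simp only
  rw [ENNReal.toReal_ofReal (by positivity), Complex.real_smul]
  push_cast
  ring

lemma integral_cauchyMeasure (hα : 0 < α) (β : ℝ) (f : ℝ → ℂ) :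
    ∫ τ, f τ ∂cauchyMeasure β α.toNNReal =
      ((α / Real.pi : ℝ) : ℂ) * ∫ τ, f τ / ((α ^ 2 + (τ - β) ^ 2 : ℝ) : ℂ) := by
  rw [cauchyMeasure_toNNReal hα, integral_withDensity_eq_integral_toReal_smul (by fun_prop)
    (ae_of_all _ fun _ => ENNReal.ofReal_lt_top), ← integral_const_mul]
  congr 1
  funext τ
  rw [ENNReal.toReal_ofReal (by positivity), Complex.real_smul]
  push_cast
  ring

lemma measurable_booleMap (α β : ℝ) : Measurable (booleMap α β) :=
  Measurable.ite (measurableSet_singleton β) measurable_const (by fun_prop)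

/-- Almost everywhere convergence along the doubling map of the circle transfers to the Boole map
of the line. -/
lemma ae_tendsto_average_booleMap (hα : 0 < α) (β : ℝ) (κ : ℕ → ℕ) {f : ℝ → ℂ}
    (hf : Measurable f) {l : ℂ}
    (h : ∀ᵐ x, Tendsto (fun N => doublingAverage κ (f ∘ cauchyCot α β) N x) atTop (𝓝 l)) :
    ∀ᵐ x : ℝ, Tendsto (fun N : ℕ => (N : ℂ)⁻¹ * ∑ n ∈ Finset.range N,
      f ((booleMap α β)^[κ n] x)) atTop (𝓝 l) := by
  refine ae_of_ae_cauchyMeasure hα (β := β) ?_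
  have hm : ∀ N : ℕ, Measurable fun x : ℝ => (N : ℂ)⁻¹ * ∑ n ∈ Finset.range N,
      f ((booleMap α β)^[κ n] x) := fun N =>
    (Finset.measurable_fun_sum _ fun n _ =>
      hf.comp ((measurable_booleMap α β).iterate (κ n))).const_mul _
  rw [← map_cauchyCot hα β, ae_map_iff (measurable_cauchyCot α β).aemeasurable
    (measurableSet_tendsto_fun hm measurable_const)]
  filter_upwards [h] with θ hθ
  simp_rw [booleMap_iterate_cauchyCot hα]
  exact hθ

end cauchyMeasure

theorem IsGoodUniversal.ae_tendsto_average_zetaDeriv {α : ℝ} (hα : 0 < α) (β : ℝ) {p : ℝ≥0∞}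
    (hp : 1 ≤ p) {κ : ℕ → ℕ} (hgood : IsGoodUniversal p κ) (hκ : IsUniformlyDistributedInt κ)
    (k : ℕ) {s : ℂ} (hs : -1 / 2 < s.re) (hs1 : s.re ≠ 1)
    (h : Function.Injective κ ∨
      MemLp (fun τ : ℝ => zetaDeriv k (s + Complex.I * τ)) p (cauchyMeasure β α.toNNReal)) :
    ∀ᵐ x : ℝ, Tendsto (fun N : ℕ => (N : ℂ)⁻¹ * ∑ n ∈ Finset.range N,
      zetaDeriv k (s + Complex.I * ((booleMap α β)^[κ n] x : ℝ)))
      atTop (𝓝 (zetaCauchyIntegral α β k s)) := by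
  obtain ⟨f, hf⟩ : ∃ f : ℝ → ℂ, f = fun τ : ℝ => zetaDeriv k (s + Complex.I * τ) := ⟨_, rfl⟩
  have hfm : Measurable f := hf ▸ (continuous_zetaDeriv_vertical k hs1).measurable
  have hcot := (measurable_cauchyCot α β).aemeasurable (μ := volume)
  have hI : Integrable (f ∘ cauchyCot α β) := by
    rw [← integrable_map_measure hfm.aestronglyMeasurable hcot, map_cauchyCot hα,
      integrable_cauchyMeasure_iff hα, hf]
    exact integrable_zetaCauchyIntegrand hα β k hs hs1
  have hl : ∫ x, (f ∘ cauchyCot α β) x = zetaCauchyIntegral α β k s := by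
    simp_rw [Function.comp_apply]
    rw [← integral_map hcot hfm.aestronglyMeasurable (f := f), map_cauchyCot hα,
      integral_cauchyMeasure hα, hf]
    rfl
  have key := ae_tendsto_average_booleMap hα β κ hfm (l := zetaCauchyIntegral α β k s) <| by
    rw [← hl]
    rcases h with hinj | hLp
    · obtain ⟨a, C, ha0, ha1, hC, hb⟩ := exists_norm_zetaDeriv_le_rpow k hs hs1
      obtain ⟨D, hD, hb'⟩ := exists_norm_comp_cauchyCot_le hα β ha0.le hC (f := f) (hf ▸ hb)
      refine hgood.ae_tendsto_doublingAverage_of_injective hp hκ hinj hI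
        (Real.one_lt_rpow one_lt_two ha0) ?_ hD hb'
      simpa using Real.rpow_lt_rpow_of_exponent_lt one_lt_two ha1
    · refine hgood.ae_tendsto_doublingAverage hp hκ ?_
      rwa [← memLp_map_measure_iff hfm.aestronglyMeasurable hcot, map_cauchyCot hα, hf]
  simpa only [hf] using key

theorem theorem9 (α β : ℝ) (hα : 0 < α) (p : ℝ≥0∞) (hp : 1 ≤ p) (κ : ℕ → ℕ)
    (hgood : IsGoodUniversal p κ) (hhart : IsHartmanUniformlyDistributed κ)
    (k : ℕ) (s : ℂ) (hs : -1 / 2 < s.re) (hs1 : s.re ≠ 1) :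
    -- the averages converge almost everywhere to the Cauchy-weighted integral
    Integrable (zetaCauchyIntegrand α β k s) volume ∧
    ((Function.Injective κ ∨
        MemLp (fun τ : ℝ => zetaDeriv k (s + Complex.I * τ)) p (cauchyMeasure β α.toNNReal)) →
      ∀ᵐ x : ℝ, Tendsto
        (fun N : ℕ => (N : ℂ)⁻¹ *
          ∑ n ∈ Finset.range N, zetaDeriv k (s + Complex.I * ((booleMap α β)^[κ n] x : ℝ)))
        atTop (𝓝 (zetaCauchyIntegral α β k s))) ∧
    -- the value of the integral
    (s.re < 1 → s ≠ 1 - α - Complex.I * β →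
      zetaCauchyIntegral α β k s =
        zetaDeriv k (s + α + Complex.I * β) + poleCorrection α β k s) ∧
    Tendsto (stieltjesSeq k) atTop (𝓝 (stieltjesConstant k)) ∧
    (s.re < 1 → s = 1 - α - Complex.I * β →
      zetaCauchyIntegral α β k s =
        (-1) ^ k * (stieltjesConstant k : ℂ) - (k.factorial : ℂ) / (2 * (α : ℂ)) ^ (k + 1)) ∧
    (1 < s.re → zetaCauchyIntegral α β k s = zetaDeriv k (s + α + Complex.I * β)) := by
  exact ⟨integrable_zetaCauchyIntegrand hα β k hs hs1,
    hgood.ae_tendsto_average_zetaDeriv hα β hp hhart.1 k hs hs1,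
    fun h => zetaCauchyIntegral_eq_zetaDeriv_add_poleCorrection hα β k hs h,
    tendsto_stieltjesSeq k,
    fun h => zetaCauchyIntegral_eq_stieltjes hα β k hs h,
    zetaCauchyIntegral_of_one_lt_re hα β k⟩
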